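/- Let $N\ge 1$, $\Gamma=\Gamma(N)\subset SL_2(\mathbb Z)$ and $\sigma\in SL_2(\mathbb Z)$. **Notation.** For $\alpha=\begin{pmatrix}a&b\\c&d\end{pmatrix}\in GL_2^+(\mathbb Q)$ and $f:\mathbb H\to\mathbb C$ put $(f|_k\alpha)(z)=\det(\alpha)^{k/2}(cz+d)^{-k}f\left(\frac{az+b}{cz+d}\right)$. Let $\mathcal M=\bigoplus_{k\ge 0}\bigcup_{M\ge1}\mathcal M_k(\Gamma(M))$ be the tower of modular forms, and $\mathcal{QM}$ the tower of quasimodular forms, i.e. the span of all holomorphic $f:\mathbb H\to\mathbb C$ such that for some $M\ge 1$, $k,s\ge 0$ there are holomorphic $f_0,\dots,f_s:\mathbb H\to\mathbb C$, $f_s\neq 0$, with $(f|_k\gamma)(z)=\sum_{j=0}^s f_j(z)\left(\frac{c}{cz+d}\right)^j$ for all $\gamma=\begin{pmatrix}a&b\\c&d\end{pmatrix}\in\Gamma(M)$, and with each $f_j|_{k-2j}\alpha$ ($\alpha\in SL_2(\mathbb Z)$) bounded at $i\infty$. Let $G_2(z)=-\frac1{24}+\sum_{n\ge1}\sigma_1(n)e^{2\pi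 i n z}$ and let $\Delta$ be the discriminant modular form of weight $12$. By the structure theorem of Kaneko and Zagier every $f\in\mathcal{QM}$ is uniquely of the form $f=\sum_i a_i(f)G_2^i$ with $a_i(f)\in\mathcal M$. On modular forms $g$ of weight $k$ set $Y(g)=\frac k2 g$ and $X(g)=\frac1{2\pi i}\frac{dg}{dz}-\frac1{12\pi i}\frac{d}{dz}(\log\Delta)\,Y(g)$, extend these and $|\alpha:=|_k\alpha$ linearly to $\mathcal M$, and for $f\in\mathcal{QM}$ set $$f||\alpha=\sum_i (a_i(f)|\alpha)G_2^i,\qquad X(f)=\sum_i X(a_i(f))G_2^i,\qquad Y(f)=\sum_i Y(a_i(f))G_2^i .$$ For $\delta\in GL_2^+(\mathbb Q)$ put $\mu_\delta=\frac1{12\pi i}\frac{d}{dz}\log\frac{\Delta|_{12}\delta}{\Delta}$. Let $\mathcal Q_\sigma(\Gamma)$ be the space of functions of finite support $F:\Gamma\backslash GL_2^+(\mathbb Q)\to\mathcal{QM}$, $\Gamma\alpha\mapsto F_\alpha$, with $F_{\alpha\gamma}=F_\alpha||\sigma\gamma\sigma^{-1}$ for all $\gamma\in\Gamma$, and let $\mathcal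 Q(\Gamma)=\mathcal Q_1(\Gamma)$. For $F^1\in\mathcal Q_\sigma(\Gamma)$ and $F^2\in\mathcal Q(\Gamma)$ put $$(F^1*F^2)_\alpha=\sum_{\beta\in\Gamma\backslash GL_2^+(\mathbb Q)}F^1_{\beta\sigma}\cdot\left(F^2_{\alpha\sigma^{-1}\beta^{-1}}||\beta\right).$$ Let $\mathcal H_1$ be the complex Hopf algebra that as an algebra is the universal enveloping algebra of the Lie algebra with generators $X,Y,\delta_n$ ($n\ge1$) and relations $[Y,X]=X$, $[X,\delta_n]=\delta_{n+1}$, $[Y,\delta_n]=n\delta_n$, $[\delta_k,\delta_l]=0$, with coproduct determined by $\Delta(X)=X\otimes1+1\otimes X+\delta_1\otimes Y$, $\Delta(Y)=Y\otimes1+1\otimes Y$, $\Delta(\delta_1)=\delta_1\otimes1+1\otimes\delta_1$. **Theorem.** The product $*$ is well defined and bilinear, takes values in $\mathcal Q_\sigma(\Gamma)$, and is a right action: $(F^1*F^2)*F^3=F^1*(F^2*F^3)$ for $F^1\in\mathcal Q_\sigma(\Gamma)$, $F^2,F^3\in\mathcal Q(\Gamma)$. Moreover: (a) $\mathcal Q_\sigma(\Gamma)$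 is an $\mathcal H_1$-module via $$X(F)_\alpha=X(F_\alpha),\qquad Y(F)_\alpha=Y(F_\alpha),\qquad \delta_n(F)_\alpha=X^{n-1}(\mu_{\alpha\sigma^{-1}})\cdot F_\alpha\qquad(n\ge1,\ \alpha\in GL_2^+(\mathbb Q)).$$ (b) With this action on $\mathcal Q_\sigma(\Gamma)$, and the one for $\sigma=1$ on $\mathcal Q(\Gamma)$, $\mathcal H_1$ has a Hopf action on the right $\mathcal Q(\Gamma)$-module $\mathcal Q_\sigma(\Gamma)$: for all $h\in\mathcal H_1$, $F^1\in\mathcal Q_\sigma(\Gamma)$, $F^2\in\mathcal Q(\Gamma)$, $$h(F^1*F^2)=\sum h_{(1)}(F^1)*h_{(2)}(F^2),\qquad \Delta(h)=\sum h_{(1)}\otimes h_{(2)}.$$ -/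

import Mathlib

open scoped MatrixGroups Manifold TensorProduct DirectSum ModularForm

noncomputable section

namespace QMHecke

/-- Symbols for the generators `X`, `Y`, `δ₁, δ₂, …`; the symbol `d n` stands for `δ_{n+1}`. -/
inductive Gen : Type
  | x : Gen
  | y : Gen
  | d : ℕ → Gen

section LieAlgebraL1

/-- The relations `[Y,X] = X`, `[X,δ_n] = δ_{n+1}`, `[Y,δ_n] = n δ_n`, `[δ_k,δ_l] = 0`. -/
inductive Relator : FreeLieAlgebra ℂ Gen → Prop
  | yx : Relator (⁅FreeLieAlgebra.of ℂ Gen.y, FreeLieAlgebra.of ℂ Gen.x⁆ - FreeLieAlgebra.of ℂ Gen.x)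
  | xd (n : ℕ) : Relator (⁅FreeLieAlgebra.of ℂ Gen.x, FreeLieAlgebra.of ℂ (Gen.d n)⁆ - FreeLieAlgebra.of ℂ (Gen.d (n + 1)))
  | yd (n : ℕ) : Relator (⁅FreeLieAlgebra.of ℂ Gen.y, FreeLieAlgebra.of ℂ (Gen.d n)⁆ - ((n : ℂ) + 1) • FreeLieAlgebra.of ℂ (Gen.d n))
  | dd (k l : ℕ) : Relator ⁅FreeLieAlgebra.of ℂ (Gen.d k), FreeLieAlgebra.of ℂ (Gen.d l)⁆

/-- The ideal of the free Lie algebra generated by the relations. -/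
def relIdeal : LieIdeal ℂ (FreeLieAlgebra ℂ Gen) :=
  LieSubmodule.lieSpan ℂ (FreeLieAlgebra ℂ Gen) {r | Relator r}

/-- The complex Lie algebra `𝓛₁` with generators `X`, `Y`, `δ_n` (`n ≥ 1`) and the relations
above. -/
abbrev L1 : Type := FreeLieAlgebra ℂ Gen ⧸ relIdeal

/-- The quotient map. -/
def toL1 : FreeLieAlgebra ℂ Gen →ₗ⁅ℂ⁆ L1 where
  toLinearMap := (LieSubmodule.Quotient.mk' relIdeal : FreeLieAlgebra ℂ Gen →ₗ[ℂ] L1)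
  map_lie' := rfl

theorem toL1_relator {r : FreeLieAlgebra ℂ Gen} (h : Relator r) : toL1 r = 0 :=
  (LieSubmodule.Quotient.mk_eq_zero').mpr (LieSubmodule.subset_lieSpan h)

/-- The universal property of `𝓛₁`. -/
def liftL1 {L : Type*} [LieRing L] [LieAlgebra ℂ L] (f : FreeLieAlgebra ℂ Gen →ₗ⁅ℂ⁆ L)
    (hf : ∀ r, Relator r → f r = 0) : L1 →ₗ⁅ℂ⁆ L where
  toLinearMap := Submodule.liftQ relIdeal.toSubmodule (f : FreeLieAlgebra ℂ Gen →ₗ[ℂ] L) <| by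
    intro x hx
    have h : relIdeal ≤ f.ker :=
      LieSubmodule.lieSpan_le.mpr fun r hr => (LieHom.mem_ker).mpr (hf r hr)
    exact (LieHom.mem_ker).mp (h hx)
  map_lie' := by
    intro a b
    induction a using Quotient.inductionOn'
    induction b using Quotient.inductionOn'
    exact f.map_lie _ _

theorem liftL1_toL1 {L : Type*} [LieRing L] [LieAlgebra ℂ L] (f : FreeLieAlgebra ℂ Gen →ₗ⁅ℂ⁆ L)
    (hf : ∀ r, Relator r → f r = 0) (r : FreeLieAlgebra ℂ Gen) : liftL1 f hf (toL1 r) = f r := rfl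

end LieAlgebraL1

/-- The algebra `𝓗₁`, the universal enveloping algebra of `𝓛₁`. -/
def H1 : Type := UniversalEnvelopingAlgebra ℂ L1

namespace H1

instance : Ring H1 := inferInstanceAs (Ring (UniversalEnvelopingAlgebra ℂ L1))
instance : Algebra ℂ H1 := inferInstanceAs (Algebra ℂ (UniversalEnvelopingAlgebra ℂ L1))

section Construction

attribute [local instance 100] LieRing.ofAssociativeRing

/-- The canonical Lie map to `𝓗₁`. -/
def incl : FreeLieAlgebra ℂ Gen →ₗ⁅ℂ⁆ H1 :=
  LieHom.comp (UniversalEnvelopingAlgebra.ι ℂ : L1 →ₗ⁅ℂ⁆ UniversalEnvelopingAlgebra ℂ L1) toL1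

/-- The image in `𝓗₁` of a generator. -/
def gen (g : Gen) : H1 := incl (FreeLieAlgebra.of ℂ g)

/-- The generator `X`. -/
def X : H1 := gen Gen.x

/-- The generator `Y`. -/
def Y : H1 := gen Gen.y

/-- The generators `δ_n`: `δ n` stands for `δ_{n+1}`. -/
def δ (n : ℕ) : H1 := gen (Gen.d n)

theorem incl_relator {r : FreeLieAlgebra ℂ Gen} (h : Relator r) : incl r = 0 := by
  change UniversalEnvelopingAlgebra.ι ℂ (toL1 r) = 0
  rw [toL1_relator h, map_zero]

theorem Y_X : Y * X - X * Y = X := by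
  have h := incl_relator Relator.yx
  rwa [map_sub, LieHom.map_lie, sub_eq_zero] at h

theorem X_δ (n : ℕ) : X * δ n - δ n * X = δ (n + 1) := by
  have h := incl_relator (Relator.xd n)
  rwa [map_sub, LieHom.map_lie, sub_eq_zero] at h

theorem Y_δ (n : ℕ) : Y * δ n - δ n * Y = ((n : ℂ) + 1) • δ n := by
  have h := incl_relator (Relator.yd n)
  rwa [map_sub, LieHom.map_lie, map_smul, sub_eq_zero] at h

theorem δ_δ (k l : ℕ) : δ k * δ l = δ l * δ k := by
  have h := incl_relator (Relator.dd k l)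
  rwa [LieHom.map_lie, LieRing.of_associative_ring_bracket, sub_eq_zero] at h

section lift

variable {A : Type*} [Ring A] [Algebra ℂ A]

/-- The universal property of `𝓗₁` as the algebra with generators `X`, `Y`, `δ_n`. -/
theorem exists_lift (x y : A) (d : ℕ → A) (hyx : y * x - x * y = x)
    (hxd : ∀ n, x * d n - d n * x = d (n + 1))
    (hyd : ∀ n, y * d n - d n * y = ((n : ℂ) + 1) • d n)
    (hdd : ∀ k l, d k * d l = d l * d k) :
    ∃ f : H1 →ₐ[ℂ] A, f X = x ∧ f Y = y ∧ ∀ n, f (δ n) = d n := by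
  let v : Gen → A := fun g => match g with
    | Gen.x => x
    | Gen.y => y
    | Gen.d n => d n
  let φ : FreeLieAlgebra ℂ Gen →ₗ⁅ℂ⁆ A := FreeLieAlgebra.lift ℂ v
  have hφ : ∀ r, Relator r → φ r = 0 := by
    intro r hr
    cases hr with
    | yx => simpa [φ, v, LieRing.of_associative_ring_bracket, sub_eq_zero] using hyx
    | xd n => simpa [φ, v, LieRing.of_associative_ring_bracket, sub_eq_zero] using hxd n
    | yd n => simpa [φ, v, LieRing.of_associative_ring_bracket, sub_eq_zero] using hyd n
    | dd k l => simpa [φ, v, LieRing.of_associative_ring_bracket, sub_eq_zero] using hdd k l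
  let F : UniversalEnvelopingAlgebra ℂ L1 →ₐ[ℂ] A :=
    UniversalEnvelopingAlgebra.lift ℂ (liftL1 φ hφ)
  have hF : ∀ g, F (gen g) = v g := fun g =>
    (UniversalEnvelopingAlgebra.lift_ι_apply ℂ (liftL1 φ hφ) (toL1 (FreeLieAlgebra.of ℂ g))).trans
      (FreeLieAlgebra.lift_of_apply v g)
  exact ⟨F, hF Gen.x, hF Gen.y, fun n => hF (Gen.d n)⟩

theorem hom_ext {f g : H1 →ₐ[ℂ] A} (hx : f X = g X) (hy : f Y = g Y) (hd : f (δ 0) = g (δ 0)) :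
    f = g := by
  have hδ : ∀ n, f (δ n) = g (δ n) := by
    intro n
    induction n with
    | zero => exact hd
    | succ n ih => rw [← X_δ n]; simp only [map_sub, map_mul, hx, ih]
  refine UniversalEnvelopingAlgebra.hom_ext (R := ℂ) (L := L1) (A := A) ?_
  have key : ((f : H1 →ₗ⁅ℂ⁆ A).comp incl) = ((g : H1 →ₗ⁅ℂ⁆ A).comp incl) := by
    refine FreeLieAlgebra.hom_ext fun t => ?_
    cases t with
    | x => exact hx
    | y => exact hy
    | d n => exact hδ n
  refine LieHom.ext fun a => ?_
  obtain ⟨r, rfl⟩ := LieSubmodule.Quotient.surjective_mk' relIdeal a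
  exact LieHom.congr_fun key r

end lift

section Hopf

/-- The commutative subalgebra generated by the `δ_n`. -/
def D : Subalgebra ℂ H1 := Algebra.adjoin ℂ (Set.range δ)

theorem δ_mem (n : ℕ) : δ n ∈ D := Algebra.subset_adjoin ⟨n, rfl⟩

theorem D_comm {u v : H1} (hu : u ∈ D) (hv : v ∈ D) : u * v = v * u := by
  refine Algebra.adjoin_induction₂ (hx := hu) (hy := hv) (p := fun x y _ _ => x * y = y * x)
    ?_ ?_ ?_ ?_ ?_ ?_ ?_ ?_
  · rintro _ _ ⟨k, rfl⟩ ⟨l, rfl⟩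
    exact δ_δ k l
  · intro r s
    exact (map_mul (algebraMap ℂ H1) r s).symm.trans
      ((congrArg _ (mul_comm r s)).trans (map_mul _ _ _))
  · intro r x _
    exact Algebra.commutes r x
  · intro r x _
    exact (Algebra.commutes r x).symm
  · intro x y z _ _ _ h1 h2
    rw [add_mul, mul_add, h1, h2]
  · intro x y z _ _ _ h1 h2
    rw [add_mul, mul_add, h1, h2]
  · intro x y z _ _ _ h1 h2
    rw [mul_assoc, h2, ← mul_assoc, h1, mul_assoc]
  · intro x y z _ _ _ h1 h2
    rw [← mul_assoc, h1, mul_assoc, h2, mul_assoc]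

theorem ad_mem {z : H1} (hz : ∀ n, z * δ n - δ n * z ∈ D) {u : H1} (hu : u ∈ D) :
    z * u - u * z ∈ D := by
  refine Algebra.adjoin_induction (hx := hu) (p := fun u _ => z * u - u * z ∈ D) ?_ ?_ ?_ ?_
  · rintro _ ⟨n, rfl⟩
    exact hz n
  · intro r
    rw [Algebra.commutes r z, sub_self]
    exact D.zero_mem
  · intro a b _ _ ha hb
    have h : z * (a + b) - (a + b) * z = (z * a - a * z) + (z * b - b * z) := by noncomm_ring
    rw [h]
    exact D.add_mem ha hb
  · intro a b ha' hb' ha hb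
    have h : z * (a * b) - (a * b) * z = (z * a - a * z) * b + a * (z * b - b * z) := by
      noncomm_ring
    rw [h]
    exact D.add_mem (D.mul_mem ha hb') (D.mul_mem ha' hb)

theorem adX_mem {u : H1} (hu : u ∈ D) : X * u - u * X ∈ D :=
  ad_mem (fun n => by rw [X_δ]; exact δ_mem _) hu

theorem adY_mem {u : H1} (hu : u ∈ D) : Y * u - u * Y ∈ D :=
  ad_mem (fun n => by rw [Y_δ]; exact D.smul_mem (δ_mem _) _) hu

/-- `X ⊗ 1 + 1 ⊗ X + δ₁ ⊗ Y`. -/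
def cX : H1 ⊗[ℂ] H1 := X ⊗ₜ 1 + 1 ⊗ₜ X + δ 0 ⊗ₜ Y

/-- `Y ⊗ 1 + 1 ⊗ Y`. -/
def cY : H1 ⊗[ℂ] H1 := Y ⊗ₜ 1 + 1 ⊗ₜ Y

/-- `δ₁ ⊗ 1 + 1 ⊗ δ₁` and its iterated commutators with `cX`. -/
def cδ : ℕ → H1 ⊗[ℂ] H1
  | 0 => δ 0 ⊗ₜ 1 + 1 ⊗ₜ δ 0
  | n + 1 => cX * cδ n - cδ n * cX

/-- `D ⊗ D`. -/
def DD : Submodule ℂ (H1 ⊗[ℂ] H1) := Submodule.span ℂ {t | ∃ u ∈ D, ∃ v ∈ D, t = u ⊗ₜ[ℂ] v}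

theorem tmul_mem_DD {u v : H1} (hu : u ∈ D) (hv : v ∈ D) : u ⊗ₜ[ℂ] v ∈ DD :=
  Submodule.subset_span ⟨u, hu, v, hv, rfl⟩

theorem DD_comm {s t : H1 ⊗[ℂ] H1} (hs : s ∈ DD) (ht : t ∈ DD) : s * t = t * s := by
  induction hs using Submodule.span_induction with
  | zero => rw [zero_mul, mul_zero]
  | add a b _ _ ha hb => rw [add_mul, mul_add, ha, hb]
  | smul c a _ ha => rw [smul_mul_assoc, mul_smul_comm, ha]
  | mem a ha =>
    obtain ⟨u, hu, v, hv, rfl⟩ := ha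
    induction ht using Submodule.span_induction with
    | zero => rw [zero_mul, mul_zero]
    | add a b _ _ ha hb => rw [add_mul, mul_add, ha, hb]
    | smul c a _ ha => rw [smul_mul_assoc, mul_smul_comm, ha]
    | mem b hb =>
      obtain ⟨u', hu', v', hv', rfl⟩ := hb
      rw [Algebra.TensorProduct.tmul_mul_tmul, Algebra.TensorProduct.tmul_mul_tmul,
        D_comm hu hu', D_comm hv hv']

theorem adcX_mem {t : H1 ⊗[ℂ] H1} (ht : t ∈ DD) : cX * t - t * cX ∈ DD := by
  induction ht using Submodule.span_induction with
  | zero => simp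
  | add a b _ _ ha hb =>
    have h : cX * (a + b) - (a + b) * cX = (cX * a - a * cX) + (cX * b - b * cX) := by
      noncomm_ring
    rw [h]
    exact DD.add_mem ha hb
  | smul c a _ ha =>
    rw [smul_mul_assoc, mul_smul_comm, ← smul_sub]
    exact DD.smul_mem c ha
  | mem a ha =>
    obtain ⟨u, hu, v, hv, rfl⟩ := ha
    have h : cX * (u ⊗ₜ[ℂ] v) - (u ⊗ₜ[ℂ] v) * cX = (X * u - u * X) ⊗ₜ[ℂ] v +
        u ⊗ₜ[ℂ] (X * v - v * X) + (δ 0 * u) ⊗ₜ[ℂ] (Y * v - v * Y) := by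
      simp only [cX, add_mul, mul_add, Algebra.TensorProduct.tmul_mul_tmul, one_mul, mul_one,
        TensorProduct.sub_tmul, TensorProduct.tmul_sub, D_comm hu (δ_mem 0)]
      abel
    rw [h]
    exact DD.add_mem (DD.add_mem (tmul_mem_DD (adX_mem hu) hv) (tmul_mem_DD hu (adX_mem hv)))
      (tmul_mem_DD (D.mul_mem (δ_mem 0) hu) (adY_mem hv))

theorem cδ_mem (n : ℕ) : cδ n ∈ DD := by
  induction n with
  | zero => exact DD.add_mem (tmul_mem_DD (δ_mem 0) D.one_mem) (tmul_mem_DD D.one_mem (δ_mem 0))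
  | succ n ih => exact adcX_mem ih

theorem cY_cX : cY * cX - cX * cY = cX := by
  have h1 : Y * X = X * Y + X := by rw [← sub_eq_iff_eq_add']; exact Y_X
  have h2 : Y * δ 0 = δ 0 * Y + δ 0 := by
    rw [← sub_eq_iff_eq_add', Y_δ]; simp
  simp only [cX, cY, add_mul, mul_add, Algebra.TensorProduct.tmul_mul_tmul, one_mul, mul_one, h1,
    h2, TensorProduct.add_tmul, TensorProduct.tmul_add]
  abel

/-- In any algebra, the relation `[y, d_n] = n d_n` propagates from `n = 1`. -/
theorem weight_step {A : Type*} [Ring A] [Algebra ℂ A] {x y : A} {d : ℕ → A}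
    (hyx : y * x - x * y = x) (hxd : ∀ n, x * d n - d n * x = d (n + 1))
    (h0 : y * d 0 - d 0 * y = d 0) (n : ℕ) :
    y * d n - d n * y = ((n : ℂ) + 1) • d n := by
  induction n with
  | zero => simpa using h0
  | succ n ih =>
    have h : y * d (n + 1) - d (n + 1) * y = (y * x - x * y) * d n - d n * (y * x - x * y) +
        (x * (y * d n - d n * y) - (y * d n - d n * y) * x) := by
      rw [← hxd n]; noncomm_ring
    rw [h, hyx, ih, mul_smul_comm, smul_mul_assoc, ← smul_sub, hxd n]
    push_cast
    rw [add_smul (_ + _), one_smul, add_comm]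

theorem cY_cδ (n : ℕ) : cY * cδ n - cδ n * cY = ((n : ℂ) + 1) • cδ n := by
  refine weight_step cY_cX (fun _ => rfl) ?_ n
  have h2 : Y * δ 0 = δ 0 * Y + δ 0 := by
    rw [← sub_eq_iff_eq_add', Y_δ]; simp
  simp only [cδ, cY, add_mul, mul_add, Algebra.TensorProduct.tmul_mul_tmul, one_mul, mul_one,
    h2, TensorProduct.add_tmul, TensorProduct.tmul_add]
  abel

theorem exists_comul : ∃ Δ : H1 →ₐ[ℂ] H1 ⊗[ℂ] H1, Δ X = cX ∧ Δ Y = cY ∧ ∀ n, Δ (δ n) = cδ n :=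
  exists_lift cX cY cδ cY_cX (fun _ => rfl) cY_cδ fun k l => DD_comm (cδ_mem k) (cδ_mem l)

theorem exists_counit : ∃ ε : H1 →ₐ[ℂ] ℂ, ε X = 0 ∧ ε Y = 0 ∧ ∀ n, ε (δ n) = 0 :=
  exists_lift 0 0 (fun _ => 0) (by simp) (by simp) (by simp) (by simp)

/-- The coproduct of `𝓗₁`: the algebra map with `Δ(X) = X ⊗ 1 + 1 ⊗ X + δ₁ ⊗ Y`,
`Δ(Y) = Y ⊗ 1 + 1 ⊗ Y`, `Δ(δ₁) = δ₁ ⊗ 1 + 1 ⊗ δ₁`. -/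
def comulHom : H1 →ₐ[ℂ] H1 ⊗[ℂ] H1 := exists_comul.choose

/-- The counit of `𝓗₁`. -/
def counitHom : H1 →ₐ[ℂ] ℂ := exists_counit.choose

theorem comulHom_X : comulHom X = X ⊗ₜ 1 + 1 ⊗ₜ X + δ 0 ⊗ₜ Y := exists_comul.choose_spec.1
theorem comulHom_Y : comulHom Y = Y ⊗ₜ 1 + 1 ⊗ₜ Y := exists_comul.choose_spec.2.1
theorem comulHom_δ : comulHom (δ 0) = δ 0 ⊗ₜ 1 + 1 ⊗ₜ δ 0 := exists_comul.choose_spec.2.2 0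
theorem counitHom_X : counitHom X = 0 := exists_counit.choose_spec.1
theorem counitHom_Y : counitHom Y = 0 := exists_counit.choose_spec.2.1
theorem counitHom_δ : counitHom (δ 0) = 0 := exists_counit.choose_spec.2.2 0

instance : Bialgebra ℂ H1 :=
  Bialgebra.ofAlgHom comulHom counitHom
    (by
      apply hom_ext <;>
      simp [comulHom_X, comulHom_Y, comulHom_δ, TensorProduct.add_tmul, TensorProduct.tmul_add,
        Algebra.TensorProduct.one_def] <;> abel)
    (by
      apply hom_ext <;>
      simp [comulHom_X, comulHom_Y, comulHom_δ, counitHom_X, counitHom_Y, counitHom_δ])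
    (by
      apply hom_ext <;>
      simp [comulHom_X, comulHom_Y, comulHom_δ, counitHom_X, counitHom_Y, counitHom_δ])

theorem comul_eq (h : H1) : Coalgebra.comul (R := ℂ) h = comulHom h := rfl

theorem counit_eq (h : H1) : Coalgebra.counit (R := ℂ) h = counitHom h := rfl

/-- The elements `S(δ_n)`. -/
def sδ : ℕ → H1
  | 0 => -δ 0
  | n + 1 => sδ n * (-X + δ 0 * Y) - (-X + δ 0 * Y) * sδ n

theorem sδ_mem (n : ℕ) : sδ n ∈ D := by
  induction n with
  | zero => exact D.neg_mem (δ_mem 0)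
  | succ n ih =>
    have h : sδ (n + 1) = (X * sδ n - sδ n * X) - δ 0 * (Y * sδ n - sδ n * Y) := by
      have e : sδ n * (δ 0 * Y) = δ 0 * (sδ n * Y) := by
        rw [← mul_assoc, D_comm ih (δ_mem 0), mul_assoc]
      simp only [sδ, mul_add, add_mul, mul_sub, e, mul_neg, neg_mul, mul_assoc]
      abel
    rw [h]
    exact D.sub_mem (adX_mem ih) (D.mul_mem (δ_mem 0) (adY_mem ih))

open MulOpposite in
theorem exists_antipode : ∃ S : H1 →ₐ[ℂ] H1ᵐᵒᵖ,
    S X = op (-X + δ 0 * Y) ∧ S Y = op (-Y) ∧ ∀ n, S (δ n) = op (sδ n) := by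
  have h2 : Y * δ 0 = δ 0 * Y + δ 0 := by
    rw [← sub_eq_iff_eq_add', Y_δ]; simp
  have h1 : Y * X = X * Y + X := by rw [← sub_eq_iff_eq_add']; exact Y_X
  have hyx : op (-Y) * op (-X + δ 0 * Y) - op (-X + δ 0 * Y) * op (-Y) = op (-X + δ 0 * Y) := by
    rw [← op_mul, ← op_mul, ← op_sub]
    congr 1
    have e : Y * (δ 0 * Y) = δ 0 * Y * Y + δ 0 * Y := by rw [← mul_assoc, h2, add_mul]
    simp only [add_mul, mul_add, neg_mul, mul_neg, neg_neg, h1, e]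
    abel
  have hxd : ∀ n, op (-X + δ 0 * Y) * op (sδ n) - op (sδ n) * op (-X + δ 0 * Y) =
      op (sδ (n + 1)) := fun n => rfl
  refine exists_lift (op (-X + δ 0 * Y)) (op (-Y)) (fun n => op (sδ n)) hyx hxd
    (weight_step hyx hxd ?_) fun k l => ?_
  · rw [← op_mul, ← op_mul, ← op_sub]
    congr 1
    simp only [sδ, neg_mul, mul_neg, neg_neg, h2]
    abel
  · rw [← op_mul, ← op_mul, D_comm (sδ_mem l) (sδ_mem k)]

/-- The antipode of `𝓗₁`, as an algebra map to the opposite algebra. -/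
def antipodeHom : H1 →ₐ[ℂ] H1ᵐᵒᵖ := exists_antipode.choose

/-- The antipode of `𝓗₁`: the anti-multiplicative map with `S(X) = -X + δ₁ Y`, `S(Y) = -Y`,
`S(δ₁) = -δ₁`. -/
def S : H1 →ₗ[ℂ] H1 :=
  (MulOpposite.opLinearEquiv ℂ).symm.toLinearMap ∘ₗ antipodeHom.toLinearMap

theorem S_X : S X = -X + δ 0 * Y :=
  congrArg MulOpposite.unop exists_antipode.choose_spec.1
theorem S_Y : S Y = -Y := congrArg MulOpposite.unop exists_antipode.choose_spec.2.1
theorem S_δ : S (δ 0) = -δ 0 := congrArg MulOpposite.unop (exists_antipode.choose_spec.2.2 0)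
theorem S_mul (a b : H1) : S (a * b) = S b * S a :=
  congrArg MulOpposite.unop (map_mul antipodeHom a b)
theorem S_one : S 1 = 1 := congrArg MulOpposite.unop (map_one antipodeHom)
theorem S_algebraMap (c : ℂ) : S (algebraMap ℂ H1 c) = algebraMap ℂ H1 c :=
  congrArg MulOpposite.unop (AlgHom.commutes antipodeHom c)

/-- A property closed under the algebra operations and true of `X`, `Y`, `δ₁` is true on `𝓗₁`. -/
theorem mem_of_generators (B : Subalgebra ℂ H1) (hX : X ∈ B) (hY : Y ∈ B) (hδ : δ 0 ∈ B)
    (h : H1) : h ∈ B := by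
  have hδ' : ∀ n, δ n ∈ B := by
    intro n
    induction n with
    | zero => exact hδ
    | succ n ih =>
      rw [← X_δ]
      exact B.sub_mem (B.mul_mem hX ih) (B.mul_mem ih hX)
  obtain ⟨f, fX, fY, fδ⟩ := exists_lift (A := B) ⟨X, hX⟩ ⟨Y, hY⟩ (fun n => ⟨δ n, hδ' n⟩)
    (Subtype.ext Y_X) (fun n => Subtype.ext (X_δ n)) (fun n => Subtype.ext (Y_δ n))
    (fun k l => Subtype.ext (δ_δ k l))
  have e : B.val.comp f = AlgHom.id ℂ H1 := by
    apply hom_ext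
    · exact congrArg Subtype.val fX
    · exact congrArg Subtype.val fY
    · exact congrArg Subtype.val (fδ 0)
  have e' : (f h : H1) = h := AlgHom.congr_fun e h
  rw [← e']
  exact (f h).2

theorem antipode_left (h : H1) :
    LinearMap.mul' ℂ H1 (S.rTensor H1 (comulHom h)) = algebraMap ℂ H1 (counitHom h) := by
  let Ψ : H1 → H1 ⊗[ℂ] H1 →ₗ[ℂ] H1 := fun c =>
    LinearMap.mul' ℂ H1 ∘ₗ ((LinearMap.mulRight ℂ c) ∘ₗ S).rTensor H1
  have key : ∀ s t : H1 ⊗[ℂ] H1, LinearMap.mul' ℂ H1 (S.rTensor H1 (s * t)) =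
      Ψ (LinearMap.mul' ℂ H1 (S.rTensor H1 s)) t := by
    intro s t
    induction t using TensorProduct.induction_on with
    | zero => simp
    | add a b ha hb => rw [mul_add, map_add, map_add, ha, hb, map_add]
    | tmul a b =>
      induction s using TensorProduct.induction_on with
      | zero => simp [Ψ]
      | add c d hc hd => rw [add_mul, map_add, map_add, hc, hd]; simp [Ψ, mul_add, add_mul]
      | tmul c d => simp [Ψ, S_mul, mul_assoc]
  let B : Subalgebra ℂ H1 :=
    { carrier := {h | LinearMap.mul' ℂ H1 (S.rTensor H1 (comulHom h)) =
        algebraMap ℂ H1 (counitHom h)}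
      algebraMap_mem' := fun c => by
        simp [Algebra.TensorProduct.algebraMap_apply, S_algebraMap]
      add_mem' := fun {a b} ha hb => by
        simp only [Set.mem_ofPred_eq, map_add] at *
        rw [ha, hb]
      mul_mem' := fun {a b} ha hb => by
        simp only [Set.mem_ofPred_eq, map_mul] at *
        rw [key, ha, ← hb]
        generalize comulHom b = t
        induction t using TensorProduct.induction_on with
        | zero => simp
        | add a b ha hb => rw [map_add, map_add, map_add, ha, hb, mul_add]
        | tmul a b =>
          simp only [Ψ, LinearMap.comp_apply, LinearMap.rTensor_tmul, LinearMap.mulRight_apply,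
            LinearMap.mul'_apply]
          rw [← Algebra.commutes, mul_assoc] }
  refine mem_of_generators B ?_ ?_ ?_ h
  · change LinearMap.mul' ℂ H1 (S.rTensor H1 (comulHom X)) = algebraMap ℂ H1 (counitHom X)
    simp [comulHom_X, counitHom_X, S_X, S_one, S_δ]
  · change LinearMap.mul' ℂ H1 (S.rTensor H1 (comulHom Y)) = algebraMap ℂ H1 (counitHom Y)
    simp [comulHom_Y, counitHom_Y, S_Y, S_one]
  · change LinearMap.mul' ℂ H1 (S.rTensor H1 (comulHom (δ 0))) =
      algebraMap ℂ H1 (counitHom (δ 0))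
    simp [comulHom_δ, counitHom_δ, S_one, S_δ]

theorem antipode_right (h : H1) :
    LinearMap.mul' ℂ H1 (S.lTensor H1 (comulHom h)) = algebraMap ℂ H1 (counitHom h) := by
  let Ψ : H1 → H1 ⊗[ℂ] H1 →ₗ[ℂ] H1 := fun c =>
    LinearMap.mul' ℂ H1 ∘ₗ ((LinearMap.mulLeft ℂ c) ∘ₗ S).lTensor H1
  have key : ∀ s t : H1 ⊗[ℂ] H1, LinearMap.mul' ℂ H1 (S.lTensor H1 (s * t)) =
      Ψ (LinearMap.mul' ℂ H1 (S.lTensor H1 t)) s := by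
    intro s t
    induction s using TensorProduct.induction_on with
    | zero => simp
    | add a b ha hb => rw [add_mul, map_add, map_add, ha, hb, map_add]
    | tmul a b =>
      induction t using TensorProduct.induction_on with
      | zero => simp [Ψ]
      | add c d hc hd => rw [mul_add, map_add, map_add, hc, hd]; simp [Ψ, mul_add, add_mul]
      | tmul c d => simp [Ψ, S_mul, mul_assoc]
  let B : Subalgebra ℂ H1 :=
    { carrier := {h | LinearMap.mul' ℂ H1 (S.lTensor H1 (comulHom h)) =
        algebraMap ℂ H1 (counitHom h)}
      algebraMap_mem' := fun c => by
        simp [Algebra.TensorProduct.algebraMap_apply, S_one]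
      add_mem' := fun {a b} ha hb => by
        simp only [Set.mem_ofPred_eq, map_add] at *
        rw [ha, hb]
      mul_mem' := fun {a b} ha hb => by
        simp only [Set.mem_ofPred_eq, map_mul] at *
        rw [key, hb, ← ha]
        generalize comulHom a = t
        induction t using TensorProduct.induction_on with
        | zero => simp
        | add a b ha hb => rw [map_add, map_add, map_add, ha, hb, add_mul]
        | tmul a b =>
          simp only [Ψ, LinearMap.comp_apply, LinearMap.lTensor_tmul, LinearMap.mulLeft_apply,
            LinearMap.mul'_apply]
          rw [Algebra.commutes, mul_assoc] }
  refine mem_of_generators B ?_ ?_ ?_ h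
  · change LinearMap.mul' ℂ H1 (S.lTensor H1 (comulHom X)) = algebraMap ℂ H1 (counitHom X)
    simp [comulHom_X, counitHom_X, S_X, S_one, S_Y]
  · change LinearMap.mul' ℂ H1 (S.lTensor H1 (comulHom Y)) = algebraMap ℂ H1 (counitHom Y)
    simp [comulHom_Y, counitHom_Y, S_Y, S_one]
  · change LinearMap.mul' ℂ H1 (S.lTensor H1 (comulHom (δ 0))) =
      algebraMap ℂ H1 (counitHom (δ 0))
    simp [comulHom_δ, counitHom_δ, S_one, S_δ]

instance : HopfAlgebra ℂ H1 where
  antipode := S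
  mul_antipode_rTensor_comul := LinearMap.ext antipode_left
  mul_antipode_lTensor_comul := LinearMap.ext antipode_right

end Hopf

end Construction

end H1
section QuasimodularHeckeOperators

open UpperHalfPlane hiding I
open Complex (I)
open CongruenceSubgroup


/-- The tower of modular forms of weight `k`: the functions on `ℍ` that are modular forms
of weight `k` for some principal congruence subgroup `Γ(N)`, `N ≥ 1`. -/
def modularTower (k : ℕ) : Submodule ℂ (ℍ → ℂ) where
  carrier := {f | ∃ N : ℕ, 0 < N ∧
    ∃ g : ModularForm ((Gamma N).map (Matrix.SpecialLinearGroup.mapGL ℝ)) (k : ℤ), ⇑g = f}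
  zero_mem' := ⟨1, one_pos, 0, rfl⟩
  add_mem' := by
    have key : ∀ (N M : ℕ), 0 < N → 0 < M → N ∣ M →
        ∀ g : ModularForm ((Gamma N).map (Matrix.SpecialLinearGroup.mapGL ℝ)) (k : ℤ),
        ∃ g' : ModularForm ((Gamma M).map (Matrix.SpecialLinearGroup.mapGL ℝ)) (k : ℤ),
          (⇑g' : ℍ → ℂ) = ⇑g := by
      intro N M hN hM hNM g
      have : NeZero N := ⟨hN.ne'⟩
      have : NeZero M := ⟨hM.ne'⟩
      refine ⟨{ toFun := g
                slash_action_eq' := ?_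
                holo' := g.holo'
                bdd_at_cusps' := ?_ }, rfl⟩
      · rintro A ⟨B, hB, rfl⟩
        refine g.slash_action_eq' _ ⟨B, ?_, rfl⟩
        rw [SetLike.mem_coe, Gamma_mem] at hB ⊢
        obtain ⟨h1, h2, h3, h4⟩ := hB
        have cast : ∀ a b : ℤ, (a : ZMod M) = (b : ZMod M) → (a : ZMod N) = (b : ZMod N) := by
          intro a b h
          rw [ZMod.intCast_eq_intCast_iff_dvd_sub] at h ⊢
          exact (Int.natCast_dvd_natCast.mpr hNM).trans h
        refine ⟨?_, ?_, ?_, ?_⟩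
        · simpa using cast _ 1 (by simpa using h1)
        · simpa using cast _ 0 (by simpa using h2)
        · simpa using cast _ 0 (by simpa using h3)
        · simpa using cast _ 1 (by simpa using h4)
      · intro c hc
        refine g.bdd_at_cusps' ?_
        rw [Subgroup.IsArithmetic.isCusp_iff_isCusp_SL2Z] at hc ⊢
        exact hc
    rintro _ _ ⟨N, hN, f, rfl⟩ ⟨M, hM, g, rfl⟩
    obtain ⟨f', hf⟩ := key N (N * M) hN (Nat.mul_pos hN hM) (Dvd.intro _ rfl) f
    obtain ⟨g', hg⟩ := key M (N * M) hM (Nat.mul_pos hN hM) (Dvd.intro_left _ rfl) g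
    exact ⟨N * M, Nat.mul_pos hN hM, f' + g', by rw [← hf, ← hg]; rfl⟩
  smul_mem' := by
    rintro c _ ⟨N, hN, f, rfl⟩
    exact ⟨N, hN, c • f, rfl⟩

theorem mdiff_of_mem_modularTower {k : ℕ} {f : ℍ → ℂ} (hf : f ∈ modularTower k) : MDiff f := by
  obtain ⟨N, _, g, rfl⟩ := hf
  exact g.holo'

/-- `f` is a quasimodular form of level `N`, weight `k` and depth `s`; the last clause is the
usual holomorphy (boundedness) condition at all cusps. -/
def IsQuasimodularForm (N k s : ℕ) (f : ℍ → ℂ) : Prop :=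
  (f = 0 ∧ s = 0) ∨
  (MDiff f ∧ ∃ g : ℕ → ℍ → ℂ,
    (∀ j ≤ s, MDiff (g j)) ∧ g s ≠ 0 ∧
    (∀ γ ∈ Gamma N, ∀ z : ℍ,
      (denom γ z) ^ (-(k : ℤ)) * f (γ • z) =
        ∑ j ∈ Finset.range (s + 1), g j z * (((γ 1 0 : ℤ) : ℂ) / denom γ z) ^ j) ∧
    (∀ j ≤ s, ∀ α : SL(2, ℤ), IsBoundedAtImInfty (g j ∣[((k : ℤ) - 2 * j)] α)))

/-- The quasimodular tower, spanned by the quasimodular forms of all levels, weights, depths. -/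
def QM : Submodule ℂ (ℍ → ℂ) :=
  Submodule.span ℂ {f | ∃ N k s : ℕ, 0 < N ∧ IsQuasimodularForm N k s f}

/-- The classical Eisenstein series `G₂ = -B₂/4 + ∑_{n ≥ 1} σ₁(n) qⁿ`. -/
def eisG2 (z : ℍ) : ℂ :=
  -((bernoulli 2 : ℚ) : ℂ) / (2 * 2) +
    ∑' n : ℕ, (ArithmeticFunction.sigma 1 (n + 1) : ℂ) *
      Complex.exp (2 * Real.pi * I * ((n + 1 : ℕ) : ℂ) * (z : ℂ))

/-- The modular form `Δ(z) = (2π)¹² q ∏ (1 - qⁿ)²⁴` of weight `12`. -/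
def bigDelta (z : ℍ) : ℂ := (2 * Real.pi) ^ 12 * ModularForm.discriminant z

/-- Inclusion of `GL₂⁺(ℚ)` in `GL₂(ℝ)`. -/
def toRealGL (α : GL(2, ℚ)⁺) : GL (Fin 2) ℝ :=
  Matrix.GeneralLinearGroup.map (Rat.castHom ℝ) (α : GL (Fin 2) ℚ)

/-- The slash action of `GL₂⁺(ℚ)` in weight `k`, normalised by `det(α)^{k/2}`:
`(f|_k α)(z) = det(α)^{k/2} (cz+d)^{-k} f((az+b)/(cz+d))`. -/
def slash (k : ℕ) (α : GL(2, ℚ)⁺) : (ℍ → ℂ) →ₗ[ℂ] (ℍ → ℂ) where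
  toFun f z := ((((toRealGL α).det : ℝ) ^ ((k : ℝ) / 2) : ℝ) : ℂ) *
    (denom (toRealGL α) z) ^ (-(k : ℤ)) * f (toRealGL α • z)
  map_add' f g := by ext z; simp only [Pi.add_apply]; ring
  map_smul' c f := by ext z; simp only [Pi.smul_apply, smul_eq_mul, RingHom.id_apply]; ring

/-- `μ_δ = (1/12πi) d/dz log (Δ|δ / Δ)`. -/
def mu (δ : GL(2, ℚ)⁺) (z : ℍ) : ℂ :=
  (1 / (12 * Real.pi * I)) *
    logDeriv ((fun w : ℍ => slash 12 δ bigDelta w / bigDelta w) ∘ ofComplex) z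

/-- The weight operator `Y(f) = (k/2) f` on modular forms of weight `k`. -/
def modY (k : ℕ) : modularTower k →ₗ[ℂ] (ℍ → ℂ) := ((k : ℂ) / 2) • (modularTower k).subtype

/-- The Ramanujan operator `X(f) = (1/2πi) f' - (1/12πi) (log Δ)' Y(f)` on modular forms of
weight `k`. -/
def modX (k : ℕ) : modularTower k →ₗ[ℂ] (ℍ → ℂ) where
  toFun f z := (1 / (2 * Real.pi * I)) * deriv ((f : ℍ → ℂ) ∘ ofComplex) z -
    (1 / (12 * Real.pi * I)) * logDeriv (bigDelta ∘ ofComplex) z * modY k f z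
  map_add' f g := by
    ext z
    have h := congrFun (Derivative.normalizedDerivOfComplex_add _ _
      (mdiff_of_mem_modularTower f.2) (mdiff_of_mem_modularTower g.2)) z
    simp only [Derivative.normalizedDerivOfComplex, Pi.add_apply, inv_eq_one_div] at h
    simp only [map_add, Pi.add_apply, Submodule.coe_add]
    rw [h]; ring
  map_smul' c f := by
    ext z
    have h := congrFun (Derivative.normalizedDerivOfComplex_smul c _
      (mdiff_of_mem_modularTower f.2)) z
    simp only [Derivative.normalizedDerivOfComplex, Pi.smul_apply, smul_eq_mul,
      inv_eq_one_div] at h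
    simp only [map_smul, Pi.smul_apply, Submodule.coe_smul, smul_eq_mul, RingHom.id_apply]
    rw [h]; ring

/-- Families `(a_{i,k})` with `a_{i,k}` a modular form of weight `k` (of some level), all but
finitely many zero: the coefficients of a polynomial in `G₂` over the modular tower. -/
abbrev Coeffs : Type := ⨁ p : ℕ × ℕ, modularTower p.2

/-- `(a_{i,k}) ↦ ∑ T_k(a_{i,k}) G₂^i`. -/
def evalWith (T : ∀ k, modularTower k →ₗ[ℂ] (ℍ → ℂ)) : Coeffs →ₗ[ℂ] (ℍ → ℂ) :=
  DirectSum.toModule ℂ (ℕ × ℕ) (ℍ → ℂ)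
    fun p => (LinearMap.mulRight ℂ (eisG2 ^ p.1)).comp (T p.2)

/-- The `G₂`-expansion of a quasimodular form: `coeffs f` is the unique family `(a_{i,k})` of
modular forms with `f = ∑ a_{i,k} G₂^i` (the value is only meaningful on the quasimodular
tower, which is the range of the evaluation map `(a_{i,k}) ↦ ∑ a_{i,k} G₂^i`). -/
def coeffs : (ℍ → ℂ) →ₗ[ℂ] Coeffs :=
  LinearMap.leftInverse (K := ℂ) (V := Coeffs) (V' := ℍ → ℂ)
    (evalWith fun k => (modularTower k).subtype)

/-- The operator `∑ a_{i,k} G₂^i ↦ ∑ T_k(a_{i,k}) G₂^i` on the quasimodular tower. -/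
def extend (T : ∀ k, modularTower k →ₗ[ℂ] (ℍ → ℂ)) : (ℍ → ℂ) →ₗ[ℂ] (ℍ → ℂ) :=
  (evalWith T).comp coeffs

/-- `f || α = ∑ (a_i(f)|α) G₂^i`. -/
def qslash (α : GL(2, ℚ)⁺) : (ℍ → ℂ) →ₗ[ℂ] (ℍ → ℂ) :=
  extend fun k => (slash k α).comp (modularTower k).subtype

/-- `X(f) = ∑ X(a_i(f)) G₂^i`. -/
def opX : (ℍ → ℂ) →ₗ[ℂ] (ℍ → ℂ) := extend modX

/-- `Y(f) = ∑ Y(a_i(f)) G₂^i`. -/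
def opY : (ℍ → ℂ) →ₗ[ℂ] (ℍ → ℂ) := extend modY

/-- Inclusion of `SL₂(ℤ)` in `GL₂⁺(ℚ)`. -/
def toGLQ : SL(2, ℤ) →* GL(2, ℚ)⁺ :=
  Matrix.SpecialLinearGroup.toGLPos.comp (Matrix.SpecialLinearGroup.map (Int.castRingHom ℚ))

/-- `Γ(N)` as a subgroup of `GL₂⁺(ℚ)`. -/
def GammaQ (N : ℕ) : Subgroup GL(2, ℚ)⁺ := (Gamma N).map toGLQ

/-- The coset space `Γ(N) \ GL₂⁺(ℚ)`. -/
abbrev Cosets (N : ℕ) : Type := Quotient (QuotientGroup.rightRel (GammaQ N))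

/-- The space `𝒬_σ(Γ(N))` of `σ`-twisted quasimodular Hecke operators of level `Γ(N)`:
functions `α ↦ F_α` from `GL₂⁺(ℚ)` to the quasimodular tower that are left `Γ(N)`-invariant,
supported on finitely many cosets in `Γ(N) \ GL₂⁺(ℚ)`, and satisfy
`F_{αγ} = F_α || σγσ⁻¹` for `γ ∈ Γ(N)`. For `σ = 1` this is `𝒬(Γ(N))`. -/
def Q (N : ℕ) (σ : SL(2, ℤ)) : Submodule ℂ (GL(2, ℚ)⁺ → ℍ → ℂ) where
  carrier := {F | (∀ α, F α ∈ QM) ∧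
    (∀ γ ∈ Gamma N, ∀ α, F (toGLQ γ * α) = F α) ∧
    ((fun α => (Quotient.mk _ α : Cosets N)) '' Function.support F).Finite ∧
    (∀ γ ∈ Gamma N, ∀ α, F (α * toGLQ γ) = qslash (toGLQ (σ * γ * σ⁻¹)) (F α))}
  zero_mem' := by
    refine ⟨fun _ => QM.zero_mem, fun _ _ _ => rfl, ?_, fun _ _ _ => ?_⟩
    · simp
    · simp
  add_mem' := by
    rintro F G ⟨h1, h2, h3, h4⟩ ⟨k1, k2, k3, k4⟩
    refine ⟨fun α => QM.add_mem (h1 α) (k1 α), fun γ hγ α => ?_, ?_, fun γ hγ α => ?_⟩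
    · simp only [Pi.add_apply, h2 γ hγ, k2 γ hγ]
    · refine (h3.union k3).subset ?_
      rw [← Set.image_union]
      exact Set.image_mono (Function.support_add F G)
    · simp only [Pi.add_apply, h4 γ hγ, k4 γ hγ, map_add]
  smul_mem' := by
    rintro c F ⟨h1, h2, h3, h4⟩
    refine ⟨fun α => QM.smul_mem c (h1 α), fun γ hγ α => ?_, ?_, fun γ hγ α => ?_⟩
    · simp only [Pi.smul_apply, h2 γ hγ]
    · exact h3.subset (Set.image_mono (Function.support_const_smul_subset c F))
    · simp only [Pi.smul_apply, h4 γ hγ, map_smul]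

/-- `(F¹ ∗ F²)_α = ∑_{β ∈ Γ(N) \ GL₂⁺(ℚ)} F¹_{βσ} · (F²_{ασ⁻¹β⁻¹} || β)`. -/
def heckeMul (N : ℕ) (σ : SL(2, ℤ)) (F G : GL(2, ℚ)⁺ → ℍ → ℂ) (α : GL(2, ℚ)⁺) : ℍ → ℂ :=
  ∑ᶠ c : Cosets N, F (c.out * toGLQ σ) * qslash c.out (G (α * (toGLQ σ)⁻¹ * c.out⁻¹))

end QuasimodularHeckeOperators

end QMHecke

end

noncomputable section

namespace QMHecke

open UpperHalfPlane hiding I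
open Complex (I)
open CongruenceSubgroup

/-! Everything rests on a few facts about modular forms. The slash action is a right action of
`GL₂⁺(ℚ)`, multiplicative because the normalisation `det^{k/2}` is. The operator `X` is the Serre
derivative `D - (k/12) E₂`, a derivation raising the weight by two. Finally `X(f|α) = X(f)|α + μ_α
Y(f|α)` (`modX_slash`), where `μ` is a weight-two cocycle, `μ_{αβ} = μ_α|β + μ_β` (`mu_mul`),
vanishing on `SL₂(ℤ)` (`mu_toGLQ`).

The structure theorem carries these to quasimodular forms. `G₂` is transcendental over the modular
tower (`ker_evalWith`), and the quasimodular tower is spanned by the products `a G₂^i`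
(`QM_eq_span`). Coefficientwise operators are therefore well defined, and identities between them
need checking only on such products. Both halves use that a polynomial identity in the lower row of
a matrix, once valid on `Γ(N)`, is valid identically.

For the product, replacing `β` by `γβ` with `γ ∈ Γ` does not change the summand, so sums over cosets
may be translated on the right. This gives equivariance (`heckeMul_mem`) and associativity
(`heckeMul_assoc`).

The elements `h` satisfying the Hopf identity form a subalgebra, since the coproduct is an algebra
map; so `X`, `Y`, `δ₁` suffice. For `X`, the correction `μ_β Y(F²||β)` is exactly the term `δ₁ ⊗ Y`,
because `δ₁(F¹)_{βσ} = μ_β F¹_{βσ}`. For `δ₁`, the identity is the cocycle relation for `ασ⁻¹ =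
(ασ⁻¹β⁻¹)β`. -/

/-! ### The normalised slash action of `GL₂⁺(ℚ)` -/

theorem det_toRealGL_pos (α : GL(2, ℚ)⁺) : 0 < ((toRealGL α).det : ℝ) := by
  have h : (0 : ℚ) < (α : GL (Fin 2) ℚ).det.val := α.2
  have e : ((toRealGL α).det : ℝ) = (((α : GL (Fin 2) ℚ).det.val : ℚ) : ℝ) := by
    simp [toRealGL, Matrix.det_fin_two]
  rw [e]
  exact_mod_cast h

theorem σ_toRealGL (α : GL(2, ℚ)⁺) (x : ℂ) : σ (toRealGL α) x = x := by
  rw [σ, if_pos (det_toRealGL_pos α)]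
  rfl

theorem toRealGL_mul (α β : GL(2, ℚ)⁺) : toRealGL (α * β) = toRealGL α * toRealGL β := by
  simp [toRealGL]

theorem toRealGL_toGLQ (γ : SL(2, ℤ)) :
    toRealGL (toGLQ γ) = Matrix.SpecialLinearGroup.mapGL ℝ γ := by
  ext i j
  simp [toRealGL, toGLQ]

/-- Mathlib's slash carries `det^{k-1}` in place of `det^{k/2}`; the two agree in weight 2 and on
determinant 1. -/
theorem slash_eq_smul (k : ℕ) (α : GL(2, ℚ)⁺) (f : ℍ → ℂ) :
    slash k α f = (((((toRealGL α).det : ℝ) ^ (1 - (k : ℝ) / 2) : ℝ)) : ℂ) •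
      (f ∣[(k : ℤ)] toRealGL α) := by
  have hd := det_toRealGL_pos α
  have hσ := σ_toRealGL α
  ext z
  have e : (((toRealGL α).det : ℝ) ^ ((k : ℝ) / 2)) =
      ((toRealGL α).det : ℝ) ^ (1 - (k : ℝ) / 2) * ((toRealGL α).det : ℝ) ^ ((k : ℤ) - 1) := by
    rw [← Real.rpow_intCast, ← Real.rpow_add hd]
    congr 1
    push_cast
    ring
  simp only [slash, LinearMap.coe_mk, AddHom.coe_mk, Pi.smul_apply, smul_eq_mul,
    ModularForm.slash_apply, hσ, abs_of_pos hd, e]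
  push_cast
  ring

theorem slash_toGLQ (k : ℕ) (γ : SL(2, ℤ)) (f : ℍ → ℂ) :
    slash k (toGLQ γ) f = f ∣[(k : ℤ)] γ := by
  rw [slash_eq_smul, toRealGL_toGLQ, Matrix.SpecialLinearGroup.det_mapGL, Units.val_one,
    Real.one_rpow, Complex.ofReal_one, one_smul]
  rfl

theorem slash_two (α : GL(2, ℚ)⁺) (f : ℍ → ℂ) : slash 2 α f = f ∣[(2 : ℤ)] toRealGL α := by
  rw [slash_eq_smul]
  simp

theorem slash_slash (k : ℕ) (α β : GL(2, ℚ)⁺) (f : ℍ → ℂ) :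
    slash k β (slash k α f) = slash k (α * β) f := by
  have hσ := σ_toRealGL β
  simp only [slash_eq_smul, ModularForm.smul_slash, hσ, toRealGL_mul, SlashAction.slash_mul,
    smul_smul, map_mul, Units.val_mul]
  rw [Real.mul_rpow (det_toRealGL_pos α).le (det_toRealGL_pos β).le, mul_comm]
  push_cast
  rfl

/-- The exponent `k/2` is additive in `k`, so no stray power of the determinant appears. -/
theorem slash_mul (k l : ℕ) (α : GL(2, ℚ)⁺) (f g : ℍ → ℂ) :
    slash (k + l) α (f * g) = slash k α f * slash l α g := by
  have hd := det_toRealGL_pos α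
  ext z
  have e : (((toRealGL α).det : ℝ) ^ (((k + l : ℕ) : ℝ) / 2)) =
      ((toRealGL α).det : ℝ) ^ ((k : ℝ) / 2) * ((toRealGL α).det : ℝ) ^ ((l : ℝ) / 2) := by
    rw [← Real.rpow_add hd]
    congr 1
    push_cast
    ring
  simp only [slash, LinearMap.coe_mk, AddHom.coe_mk, Pi.mul_apply, e]
  push_cast
  rw [neg_add, zpow_add₀ (denom_ne_zero _ z)]
  ring

theorem slash_one (k : ℕ) (f : ℍ → ℂ) : slash k 1 f = f := by
  have h := slash_toGLQ k 1 f
  rwa [map_one, SlashAction.slash_one] at h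

/-! ### The modular tower: products and slash action -/

theorem Gamma_le_of_dvd {N M : ℕ} (h : N ∣ M) : Gamma M ≤ Gamma N := by
  intro B hB
  rw [Gamma_mem] at hB ⊢
  obtain ⟨h1, h2, h3, h4⟩ := hB
  have cast : ∀ a b : ℤ, (a : ZMod M) = (b : ZMod M) → (a : ZMod N) = (b : ZMod N) := by
    intro a b h'
    rw [ZMod.intCast_eq_intCast_iff_dvd_sub] at h' ⊢
    exact (Int.natCast_dvd_natCast.mpr h).trans h'
  refine ⟨?_, ?_, ?_, ?_⟩
  · simpa using cast _ 1 (by simpa using h1)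
  · simpa using cast _ 0 (by simpa using h2)
  · simpa using cast _ 0 (by simpa using h3)
  · simpa using cast _ 1 (by simpa using h4)

/-- A modular form of level `Γ(N)` from its three defining properties. -/
def mkModularForm {N : ℕ} (hN : 0 < N) {k : ℤ} {f : ℍ → ℂ} (h1 : MDiff f)
    (h2 : ∀ γ ∈ Gamma N, f ∣[k] γ = f) (h3 : ∀ α : SL(2, ℤ), IsBoundedAtImInfty (f ∣[k] α)) :
    ModularForm ((Gamma N).map (Matrix.SpecialLinearGroup.mapGL ℝ)) k where
  toFun := f
  slash_action_eq' := by
    rintro _ ⟨γ, hγ, rfl⟩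
    exact h2 γ hγ
  holo' := h1
  bdd_at_cusps' := by
    intro c hc
    have : NeZero N := ⟨hN.ne'⟩
    rw [Subgroup.IsArithmetic.isCusp_iff_isCusp_SL2Z] at hc
    exact (OnePoint.isBoundedAt_iff_forall_SL2Z hc).mpr fun γ _ => h3 γ

/-- Boundedness at every cusp becomes boundedness at `i∞` of all `SL₂(ℤ)`-translates, which no
longer mentions the level. -/
theorem mem_modularTower_iff {k : ℕ} {f : ℍ → ℂ} :
    f ∈ modularTower k ↔ MDiff f ∧ (∃ N : ℕ, 0 < N ∧ ∀ γ ∈ Gamma N, f ∣[(k : ℤ)] γ = f) ∧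
      ∀ α : SL(2, ℤ), IsBoundedAtImInfty (f ∣[(k : ℤ)] α) := by
  constructor
  · rintro ⟨N, hN, g, rfl⟩
    have : NeZero N := ⟨hN.ne'⟩
    refine ⟨g.holo', ⟨N, hN, fun γ hγ => g.slash_action_eq' _ ⟨γ, hγ, rfl⟩⟩, fun α => ?_⟩
    exact ModularFormClass.bdd_at_infty_slash g α
  · rintro ⟨h1, ⟨N, hN, h2⟩, h3⟩
    exact ⟨N, hN, mkModularForm hN h1 h2 h3, rfl⟩

theorem mul_mem_modularTower {k l : ℕ} {f g : ℍ → ℂ} (hf : f ∈ modularTower k)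
    (hg : g ∈ modularTower l) : f * g ∈ modularTower (k + l) := by
  rw [mem_modularTower_iff] at hf hg ⊢
  obtain ⟨f1, ⟨N, hN, f2⟩, f3⟩ := hf
  obtain ⟨g1, ⟨M, hM, g2⟩, g3⟩ := hg
  push_cast
  simp only [ModularForm.mul_slash_SL2]
  exact ⟨f1.mul g1, ⟨N * M, Nat.mul_pos hN hM, fun γ hγ => by
    rw [f2 γ (Gamma_le_of_dvd (Dvd.intro _ rfl) hγ),
      g2 γ (Gamma_le_of_dvd (Dvd.intro_left _ rfl) hγ)]⟩, fun α => (f3 α).mul (g3 α)⟩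

/-- Every `α` in `GL₂⁺(ℚ)` is in `SL₂(ℤ)` times the upper triangular matrices. -/
theorem exists_SL2Z_mul_upper (α : GL(2, ℚ)⁺) :
    ∃ (γ : SL(2, ℤ)) (β : GL(2, ℚ)⁺), α = toGLQ γ * β ∧ (toRealGL β) 1 0 = 0 := by
  set a : ℚ := (α : GL (Fin 2) ℚ) 0 0 with ha
  set c : ℚ := (α : GL (Fin 2) ℚ) 1 0 with hc
  -- A coprime row orthogonal to the first column `(a, c)`; completed to a matrix of `SL₂(ℤ)`, it
  -- clears the lower left entry of `α`.
  obtain ⟨p, q, hpq, h0⟩ : ∃ p q : ℤ, IsCoprime p q ∧ (p : ℚ) * a + q * c = 0 := by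
    by_cases h : c = 0
    · exact ⟨0, 1, isCoprime_zero_left.mpr isUnit_one, by simp [h]⟩
    · refine ⟨(a / c).den, -(a / c).num, ?_, ?_⟩
      · rw [IsCoprime.neg_right_iff, Int.isCoprime_iff_gcd_eq_one, Int.gcd_comm]
        exact (a / c).reduced
      · have h1 : ((a / c).den : ℚ) * (a / c) = (a / c).num := by
          rw [mul_comm]; exact Rat.mul_den_eq_num _
        have h2 : (a / c) * c = a := by field_simp
        rw [Int.cast_neg, ← h1, Int.cast_natCast, neg_mul, mul_assoc, h2, add_neg_cancel]
  obtain ⟨g, hg⟩ := hpq.exists_SL2_row 1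
  refine ⟨g⁻¹, toGLQ g * α, by rw [map_inv, inv_mul_cancel_left], ?_⟩
  have e : (toRealGL (toGLQ g * α)) 1 0 = (((g 1 0 : ℚ) * a + (g 1 1 : ℚ) * c : ℚ) : ℝ) := by
    simp [toRealGL, toGLQ, Matrix.mul_apply, Fin.sum_univ_two, ha, hc]
  have e1 : g 1 0 = p := hg.1
  have e2 : g 1 1 = q := hg.2
  rw [e, e1, e2, h0, Rat.cast_zero]

/-- `Γ(N)` is conjugated by `α` into `Γ(M)` for some `N`. -/
theorem exists_Gamma_conj (α : GL(2, ℚ)⁺) {M : ℕ} (hM : 0 < M) :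
    ∃ N : ℕ, 0 < N ∧ ∀ x ∈ Gamma N, ∃ y ∈ Gamma M, α * toGLQ x = toGLQ y * α := by
  have : NeZero M := ⟨hM.ne'⟩
  obtain ⟨N, hN, h⟩ := exists_Gamma_le_conj (α : GL (Fin 2) ℚ) M
  refine ⟨N, Nat.pos_of_ne_zero hN, fun x hx => ?_⟩
  obtain ⟨y, hy, e⟩ := h x hx
  refine ⟨y, hy, Subtype.ext ?_⟩
  have e' : ∀ w : SL(2, ℤ), ((toGLQ w : GL(2, ℚ)⁺) : GL (Fin 2) ℚ) =
      Matrix.SpecialLinearGroup.mapGL ℚ w := by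
    intro w; ext i j; simp [toGLQ]
  rw [Subgroup.coe_mul, Subgroup.coe_mul, e', e', e, inv_mul_cancel_right]

/-- Invariance holds on a deeper level that `α` conjugates into `Γ(N)`. For the cusps, write `αγ =
γ'β` with `β` upper triangular: `f|γ'` is bounded by hypothesis, and `β` fixes `i∞`. -/
theorem slash_mem_modularTower {k : ℕ} {f : ℍ → ℂ} (α : GL(2, ℚ)⁺) (hf : f ∈ modularTower k) :
    slash k α f ∈ modularTower k := by
  rw [mem_modularTower_iff] at hf ⊢
  obtain ⟨f1, ⟨N, hN, f2⟩, f3⟩ := hf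
  refine ⟨?_, ?_, fun γ => ?_⟩
  · rw [slash_eq_smul]
    exact (f1.slash _ _).const_smul _
  · obtain ⟨M, hM, h⟩ := exists_Gamma_conj α hN
    refine ⟨M, hM, fun x hx => ?_⟩
    obtain ⟨y, hy, e⟩ := h x hx
    rw [← slash_toGLQ, slash_slash, e, ← slash_slash, slash_toGLQ, f2 y hy]
  · obtain ⟨γ', β, e, hβ⟩ := exists_SL2Z_mul_upper (α * toGLQ γ)
    rw [← slash_toGLQ, slash_slash, e, ← slash_slash, slash_toGLQ, slash_eq_smul]
    exact ((f3 γ').slash _ hβ).const_smul_left _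

/-! ### The discriminant, `E₂` and the Serre derivative -/

theorem ofReal_pi_ne_zero : (Real.pi : ℂ) ≠ 0 := by simp [Real.pi_ne_zero]

theorem ofComplex_coe_eventuallyEq {f : ℍ → ℂ} {F : ℂ → ℂ} (h : ∀ w : ℍ, f w = F w) (z : ℍ) :
    f ∘ ofComplex =ᶠ[nhds (z : ℂ)] F := by
  filter_upwards [isOpen_upperHalfPlaneSet.mem_nhds z.im_pos] with w hw
  rw [Function.comp_apply, h, ofComplex_apply_of_im_pos hw]

theorem bigDelta_eventuallyEq (z : ℍ) : bigDelta ∘ ofComplex =ᶠ[nhds (z : ℂ)]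
    fun w => (2 * Real.pi) ^ 12 * ModularForm.eta w ^ 24 :=
  ofComplex_coe_eventuallyEq
    (F := fun w => (2 * Real.pi) ^ 12 * ModularForm.eta w ^ 24) (fun _ => rfl) z

/-- `Δ` is a constant times `η²⁴`, and the logarithmic derivative of `η` is a multiple of `E₂`. -/
theorem logDeriv_bigDelta (z : ℍ) :
    logDeriv (bigDelta ∘ ofComplex) z = 2 * Real.pi * I * EisensteinSeries.E2 z := by
  have h := bigDelta_eventuallyEq z
  have hη := ModularForm.differentiableAt_eta_of_mem_upperHalfPlaneSet z.2
  rw [logDeriv_apply, h.deriv_eq, h.eq_of_nhds, ← logDeriv_apply,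
    logDeriv_const_mul _ _ (by simp [Real.pi_ne_zero]), logDeriv_fun_pow hη,
    ModularForm.logDeriv_eta_eq_E2]
  push_cast
  ring

theorem bigDelta_ne_zero (z : ℍ) : bigDelta z ≠ 0 :=
  mul_ne_zero (by simp [Real.pi_ne_zero]) (ModularForm.discriminant_ne_zero z)

theorem mdiff_bigDelta : MDiff bigDelta := by
  intro z
  rw [mdifferentiableAt_iff]
  refine DifferentiableAt.congr_of_eventuallyEq ?_ (bigDelta_eventuallyEq z)
  exact ((ModularForm.differentiableAt_eta_of_mem_upperHalfPlaneSet z.2).pow 24).const_mul _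

open Derivative in
theorem D_bigDelta : D bigDelta = EisensteinSeries.E2 * bigDelta := by
  ext z
  have h := logDeriv_bigDelta z
  rw [logDeriv_apply, Function.comp_apply, ofComplex_apply,
    div_eq_iff (bigDelta_ne_zero z)] at h
  rw [normalizedDerivOfComplex, h, Pi.mul_apply]
  have := ofReal_pi_ne_zero
  field_simp

theorem modX_eq (k : ℕ) (f : modularTower k) :
    modX k f = Derivative.serreDerivative k (f : ℍ → ℂ) := by
  ext z
  simp only [modX, LinearMap.coe_mk, AddHom.coe_mk, modY, LinearMap.smul_apply,
    Submodule.subtype_apply, Pi.smul_apply, smul_eq_mul, logDeriv_bigDelta,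
    Derivative.serreDerivative_apply, Derivative.normalizedDerivOfComplex]
  have := ofReal_pi_ne_zero
  field_simp

theorem eisG2_eq : eisG2 = (-1 / 24 : ℂ) • EisensteinSeries.E2 := by
  ext z
  rw [Pi.smul_apply, EisensteinSeries.E2_eq_tsum_cexp, eisG2, bernoulli_two,
    tsum_pnat_eq_tsum_succ (f := fun n => (ArithmeticFunction.sigma 1 n : ℂ) * _ ^ n)]
  have e : ∀ n : ℕ, Complex.exp (2 * Real.pi * I * ((n + 1 : ℕ) : ℂ) * (z : ℂ)) =
      (Complex.exp (2 * Real.pi * I * z)) ^ (n + 1) := by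
    intro n
    rw [← Complex.exp_nat_mul]
    congr 1
    ring
  simp only [e, smul_eq_mul]
  push_cast
  ring

/-! ### The cocycle `c/(cz+d)` and the cocycle `μ` -/

/-- The function `c / (c z + d)`. -/
def kappa (g : GL (Fin 2) ℝ) (z : ℍ) : ℂ := (g 1 0 : ℂ) / denom g z

theorem denom_mul {g h : GL (Fin 2) ℝ} (hh : 0 < h.det.val) (z : ℍ) :
    denom (g * h) z = denom g (h • z : ℍ) * denom h z := by
  rw [denom_cocycle_σ, σ, if_pos hh]
  rfl

/-- `kappa g` is the logarithmic derivative of `denom g`, so this is the derivative of the cocycle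
relation for `denom`; the factor `det h / denom²` is the derivative of `z ↦ h z`. -/
theorem kappa_mul_apply (g h : GL (Fin 2) ℝ) (hh : 0 < h.det.val) (z : ℍ) :
    kappa (g * h) z = h.det.val / (denom h z) ^ 2 * kappa g (h • z) + kappa h z := by
  have h1 := denom_ne_zero h z
  have h2 := denom_ne_zero g (h • z)
  have h3 := denom_mul (g := g) hh z
  have h4 := denom_ne_zero (g * h) z
  have e : denom (g * h) z = g 1 0 * (h 0 0 * z + h 0 1) + g 1 1 * (h 1 0 * z + h 1 1) := by
    simp only [denom, Units.val_mul, Matrix.mul_apply, Fin.sum_univ_two]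
    push_cast
    ring
  have e1 : ((g * h) 1 0 : ℂ) = g 1 0 * h 0 0 + g 1 1 * h 1 0 := by
    simp only [Units.val_mul, Matrix.mul_apply, Fin.sum_univ_two]
    push_cast
    ring
  have e2 : ((h.det.val : ℝ) : ℂ) = h 0 0 * h 1 1 - h 0 1 * h 1 0 := by
    simp only [Matrix.GeneralLinearGroup.val_det_apply, Matrix.det_fin_two]
    push_cast
    ring
  have e3 : denom h z = h 1 0 * z + h 1 1 := rfl
  have key : ((g * h) 1 0 : ℂ) * denom h z =
      h.det.val * g 1 0 + h 1 0 * (denom (g * h) z) := by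
    rw [e, e1, e2, e3]
    ring
  simp only [kappa]
  rw [h3] at key ⊢
  field_simp
  linear_combination key

theorem kappa_mul (g h : GL (Fin 2) ℝ) (hh : 0 < h.det.val) :
    kappa (g * h) = kappa g ∣[(2 : ℤ)] h + kappa h := by
  ext z
  have hσ (x) : σ h x = x := by
    rw [σ, if_pos hh]
    rfl
  have h1 := denom_ne_zero h z
  rw [kappa_mul_apply g h hh]
  simp only [Pi.add_apply, ModularForm.slash_apply, hσ, abs_of_pos hh]
  field_simp
  simp [mul_comm]

theorem kappa_eq_zero {g : GL (Fin 2) ℝ} (hg : g 1 0 = 0) : kappa g = 0 := by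
  ext z
  simp [kappa, hg]

/-- The transformation defect of `E₂`. -/
theorem E2_slash_SL (γ : SL(2, ℤ)) : EisensteinSeries.E2 ∣[(2 : ℤ)] γ =
    EisensteinSeries.E2 + (6 / (Real.pi * I) : ℂ) • kappa (Matrix.SpecialLinearGroup.mapGL ℝ γ) := by
  rw [EisensteinSeries.E2_slash_action]
  ext z
  have := ofReal_pi_ne_zero
  have hd : denom (Matrix.SpecialLinearGroup.mapGL ℝ γ) z ≠ 0 := denom_ne_zero _ z
  have e : EisensteinSeries.D2 γ z =
      2 * Real.pi * I * kappa (Matrix.SpecialLinearGroup.mapGL ℝ γ) z := by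
    simp only [EisensteinSeries.D2, kappa, mul_div_assoc]
    rfl
  simp only [Pi.sub_apply, Pi.add_apply, Pi.smul_apply, smul_eq_mul, e, riemannZeta_two]
  field_simp
  linear_combination (-6 * kappa (Matrix.SpecialLinearGroup.mapGL ℝ γ) z) * Complex.I_sq

open Derivative in
theorem D_slash (k : ℕ) (α : GL(2, ℚ)⁺) {f : ℍ → ℂ} (hf : MDiff f) :
    D (slash k α f) = slash (k + 2) α (D f) -
      ((k : ℂ) / (2 * Real.pi * I)) • (kappa (toRealGL α) * slash k α f) := by
  have hd := det_toRealGL_pos α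
  rw [slash_eq_smul k, slash_eq_smul (k + 2),
    normalizedDerivOfComplex_smul _ _ (hf.slash _ _), normalizedDerivOfComplex_slash hf hd]
  ext z
  have e : ((toRealGL α).det : ℝ) ^ (1 - (k : ℝ) / 2) =
      ((toRealGL α).det : ℝ) ^ (1 - ((k + 2 : ℕ) : ℝ) / 2) * ((toRealGL α).det : ℝ) := by
    rw [← Real.rpow_add_one hd.ne']
    congr 1
    push_cast
    ring
  have hd' : (((toRealGL α).val.det : ℝ) : ℂ) ≠ 0 := by
    exact_mod_cast hd.ne'
  have := ofReal_pi_ne_zero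
  simp only [Pi.smul_apply, Pi.sub_apply, Pi.mul_apply, smul_eq_mul, kappa, e]
  generalize ((toRealGL α).det : ℝ) ^ (1 - ((k + 2 : ℕ) : ℝ) / 2) = C
  simp only [Matrix.GeneralLinearGroup.val_det_apply]
  push_cast
  field_simp

open Derivative in
theorem logDeriv_comp_ofComplex (f : ℍ → ℂ) (z : ℍ) :
    logDeriv (f ∘ ofComplex) z = 2 * Real.pi * I * (D f z / f z) := by
  rw [logDeriv_apply, Function.comp_apply, ofComplex_apply, normalizedDerivOfComplex]
  have := ofReal_pi_ne_zero
  field_simp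

/-- From `D Δ = E₂ Δ`, the logarithmic derivative of `Δ|δ` is that of `Δ` slashed by `δ`, minus the
contribution of the factor `(cz+d)^{-12}`. -/
theorem mu_eq (δ : GL(2, ℚ)⁺) : mu δ = (1 / 6 : ℂ) • (slash 2 δ EisensteinSeries.E2 -
    EisensteinSeries.E2) - (1 / (Real.pi * I) : ℂ) • kappa (toRealGL δ) := by
  ext z
  have h0 : slash 12 δ bigDelta z ≠ 0 := by
    have := det_toRealGL_pos δ
    simp only [slash, LinearMap.coe_mk, AddHom.coe_mk]
    refine mul_ne_zero (mul_ne_zero ?_ (zpow_ne_zero _ (denom_ne_zero _ _))) (bigDelta_ne_zero _)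
    exact_mod_cast (Real.rpow_pos_of_pos this _).ne'
  have h1 : MDiff (slash 12 δ bigDelta) := by
    rw [slash_eq_smul]
    exact (mdiff_bigDelta.slash _ _).const_smul _
  have e : ((fun w : ℍ => slash 12 δ bigDelta w / bigDelta w) ∘ ofComplex) =
      fun w => (slash 12 δ bigDelta ∘ ofComplex) w / (bigDelta ∘ ofComplex) w := rfl
  have hz := bigDelta_ne_zero z
  rw [mu, e, logDeriv_div _ (by simpa using h0) (by simpa using hz)
    (mdifferentiableAt_iff.mp (h1 z)) (mdifferentiableAt_iff.mp (mdiff_bigDelta z)),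
    logDeriv_comp_ofComplex, logDeriv_comp_ofComplex, D_slash 12 δ mdiff_bigDelta, D_bigDelta,
    show 12 + 2 = 2 + 12 from rfl, slash_mul]
  simp only [Pi.sub_apply, Pi.mul_apply, Pi.smul_apply, smul_eq_mul]
  have := ofReal_pi_ne_zero
  field_simp
  push_cast
  ring

theorem slash_two_mul (α β : GL(2, ℚ)⁺) (f : ℍ → ℂ) :
    slash 2 (α * β) f = slash 2 β (slash 2 α f) := (slash_slash 2 α β f).symm

/-- The `E₂` part of `mu_eq` is a coboundary and `kappa` is a cocycle. -/
theorem mu_mul (α β : GL(2, ℚ)⁺) : mu (α * β) = slash 2 β (mu α) + mu β := by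
  simp only [mu_eq, slash_two_mul, toRealGL_mul, kappa_mul _ _ (det_toRealGL_pos β), map_sub,
    map_smul, ← slash_two]
  module

/-- The quasimodular defect of `E₂` cancels the `kappa` term, in accordance with `Δ|γ = Δ`. -/
theorem mu_toGLQ (γ : SL(2, ℤ)) : mu (toGLQ γ) = 0 := by
  rw [mu_eq, slash_toGLQ, toRealGL_toGLQ]
  push_cast
  rw [E2_slash_SL, add_sub_cancel_left, smul_smul, sub_eq_zero]
  congr 1
  field_simp

/-! ### The operators `X`, `Y` and the forms `μ_δ` stay in the modular tower -/

theorem isBoundedAtImInfty_D {f : ℍ → ℂ} (h1 : MDiff f) (h2 : IsBoundedAtImInfty f) :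
    IsBoundedAtImInfty (Derivative.normalizedDerivOfComplex f) := by
  rw [isBoundedAtImInfty_iff] at h2 ⊢
  obtain ⟨M, A, h⟩ := h2
  -- Cauchy's estimate on the disc of radius 1; the margin 2 keeps this disc inside `ℍ` and above
  -- height `A`.
  refine ⟨‖(2 * Real.pi * I : ℂ)⁻¹‖ * (M / 1), max A 0 + 2, fun z hz => ?_⟩
  have him : ∀ w ∈ Metric.closedBall (z : ℂ) 1, max A 0 + 1 ≤ w.im := by
    intro w hw
    have h3 : |(w - z).im| ≤ 1 := (Complex.abs_im_le_norm _).trans (by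
      rwa [← dist_eq_norm])
    rw [Complex.sub_im, abs_le] at h3
    have : (z : ℂ).im = z.im := rfl
    linarith
  rw [Derivative.normalizedDerivOfComplex, norm_mul]
  refine mul_le_mul_of_nonneg_left ?_ (norm_nonneg _)
  refine Complex.norm_deriv_le_of_forall_mem_sphere_norm_le one_pos ?_ ?_
  · refine DifferentiableOn.diffContOnCl ?_
    rw [closure_ball _ one_ne_zero]
    refine (UpperHalfPlane.mdifferentiable_iff.mp h1).mono fun w hw => ?_
    have := him w hw
    have := le_max_right A 0
    change 0 < w.im
    linarith
  · intro w hw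
    have h4 := him w (Metric.sphere_subset_closedBall hw)
    have h5 := le_max_right A 0
    have h6 := le_max_left A 0
    have hw : 0 < w.im := by linarith
    rw [Function.comp_apply, ofComplex_apply_of_im_pos hw]
    refine h _ ?_
    change A ≤ w.im
    linarith

theorem isBoundedAtImInfty_const_smul {f : ℍ → ℂ} (c : ℂ) (h : IsBoundedAtImInfty f) :
    IsBoundedAtImInfty (c • f) := h.const_smul_left c

theorem isBoundedAtImInfty_sub {f g : ℍ → ℂ} (hf : IsBoundedAtImInfty f)
    (hg : IsBoundedAtImInfty g) : IsBoundedAtImInfty (f - g) := by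
  rw [sub_eq_add_neg]
  exact hf.add hg.neg

theorem isBoundedAtImInfty_serre {k : ℂ} {f : ℍ → ℂ} (h1 : MDiff f) (h2 : IsBoundedAtImInfty f) :
    IsBoundedAtImInfty (Derivative.serreDerivative k f) := by
  have e : Derivative.serreDerivative k f = Derivative.normalizedDerivOfComplex f -
      (k * 12⁻¹ : ℂ) • (EisensteinSeries.E2 * f) := by
    ext z
    simp only [Derivative.serreDerivative_apply, Pi.sub_apply, Pi.smul_apply, Pi.mul_apply,
      smul_eq_mul]
    ring
  rw [e]
  exact isBoundedAtImInfty_sub (isBoundedAtImInfty_D h1 h2) (isBoundedAtImInfty_const_smul _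
    (EisensteinSeries.isBoundedAtImInfty_E2.mul h2))

/-- The Serre derivative commutes with the slash action of `SL₂(ℤ)`, so invariance and boundedness
at every cusp pass from `f` to `X(f)`. -/
theorem modX_mem (k : ℕ) (f : modularTower k) : modX k f ∈ modularTower (k + 2) := by
  rw [modX_eq]
  obtain ⟨f, hf⟩ := f
  rw [mem_modularTower_iff] at hf ⊢
  obtain ⟨f1, ⟨N, hN, f2⟩, f3⟩ := hf
  refine ⟨Derivative.serreDerivative_mdifferentiable _ f1, ⟨N, hN, fun γ hγ => ?_⟩, fun α => ?_⟩
  · have := Derivative.serreDerivative_slash_invariant f1 (f2 γ hγ)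
    exact_mod_cast this
  · have := Derivative.serreDerivative_slash_equivariant (k := k) f1 (γ := α)
    push_cast at this ⊢
    rw [this]
    exact isBoundedAtImInfty_serre (f1.slash _ _) (f3 α)

theorem modY_mem (k : ℕ) (f : modularTower k) : modY k f ∈ modularTower k :=
  (modularTower k).smul_mem _ f.2

theorem mdiff_kappa (g : GL (Fin 2) ℝ) : MDiff (kappa g) := by
  have e : kappa g = (g 1 0 : ℂ) • fun z : ℍ => denom g z ^ (-1 : ℤ) := by
    ext z
    simp [kappa, div_eq_mul_inv]
  rw [e]
  exact (mdifferentiable_denom_zpow g (-1)).const_smul _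

/-- As `μ` vanishes on `SL₂(ℤ)`, the cocycle relation gives `μ_δ|x = μ_{δx}` and `μ_{yδ} = μ_δ` for
integral `x`, `y`. Invariance follows when `δx = yδ`, and boundedness from `δγ = γ'β` with `β` upper
triangular, where `μ_β` has no `kappa` term. -/
theorem mu_mem (δ : GL(2, ℚ)⁺) : mu δ ∈ modularTower 2 := by
  rw [mem_modularTower_iff]
  refine ⟨?_, ?_, fun γ => ?_⟩
  · have h := E2_mdifferentiable
    rw [mu_eq, slash_two]
    exact (((h.slash _ _).sub h).const_smul _).sub ((mdiff_kappa _).const_smul _)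
  · obtain ⟨M, hM, h⟩ := exists_Gamma_conj δ one_pos
    refine ⟨M, hM, fun x hx => ?_⟩
    obtain ⟨y, -, e⟩ := h x hx
    have h1 := mu_mul δ (toGLQ x)
    rw [e, mu_mul, mu_toGLQ, mu_toGLQ, map_zero, zero_add, add_zero, slash_toGLQ] at h1
    exact h1.symm
  · obtain ⟨γ', β, e, hβ⟩ := exists_SL2Z_mul_upper (δ * toGLQ γ)
    have h1 := mu_mul δ (toGLQ γ)
    rw [e, mu_mul, mu_toGLQ, mu_toGLQ, map_zero, zero_add, add_zero, slash_toGLQ] at h1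
    rw [← h1, mu_eq, kappa_eq_zero hβ, smul_zero, sub_zero, slash_two]
    have h := EisensteinSeries.isBoundedAtImInfty_E2
    exact isBoundedAtImInfty_const_smul _ (isBoundedAtImInfty_sub (h.slash _ hβ) h)

/-- `X(f|α) = X(f)|α + μ_α Y(f|α)`. -/
theorem modX_slash (k : ℕ) (α : GL(2, ℚ)⁺) (f : modularTower k) :
    modX k ⟨slash k α f, slash_mem_modularTower α f.2⟩ =
      slash (k + 2) α (modX k f) + mu α * modY k ⟨slash k α f, slash_mem_modularTower α f.2⟩ := by
  have e : ∀ g : ℍ → ℂ, Derivative.serreDerivative k g = Derivative.normalizedDerivOfComplex g -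
      (k * 12⁻¹ : ℂ) • (EisensteinSeries.E2 * g) := by
    intro g
    ext z
    simp only [Derivative.serreDerivative_apply, Pi.sub_apply, Pi.smul_apply, Pi.mul_apply,
      smul_eq_mul]
    ring
  -- The term `-k/(2πi) κ f|α` from `D_slash` and the difference `(k/12)(E₂|α - E₂) f|α` add up to
  -- `(k/2) μ_α f|α`.
  rw [modX_eq, modX_eq, e, e, D_slash k α (mdiff_of_mem_modularTower f.2), map_sub, map_smul,
    add_comm k 2, slash_mul, mu_eq]
  ext z
  simp only [modY, Pi.sub_apply, Pi.add_apply, Pi.smul_apply, Pi.mul_apply, smul_eq_mul,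
    LinearMap.smul_apply, Submodule.subtype_apply]
  have := ofReal_pi_ne_zero
  field_simp
  ring

/-! ### The transformation law of `G₂` -/

/-- The constant in the transformation law of `G₂`. -/
def uG : ℂ := -1 / (4 * Real.pi * I)

theorem uG_ne_zero : uG ≠ 0 := by
  have := ofReal_pi_ne_zero
  simp [uG]

/-- `c / (c z + d)` for an element of `SL₂(ℤ)`. -/
def kappaSL (γ : SL(2, ℤ)) : ℍ → ℂ := kappa (Matrix.SpecialLinearGroup.mapGL ℝ γ)

theorem kappaSL_apply (γ : SL(2, ℤ)) (z : ℍ) : kappaSL γ z = ((γ 1 0 : ℤ) : ℂ) / denom γ z := by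
  simp only [kappaSL, kappa]
  rfl

theorem denom_SL (γ : SL(2, ℤ)) (z : ℍ) : denom γ z = (γ 1 0 : ℂ) * z + γ 1 1 := rfl

theorem kappaSL_mul (γ γ' : SL(2, ℤ)) (z : ℍ) :
    kappaSL (γ * γ') z = ((denom γ' z) ^ 2)⁻¹ * kappaSL γ (γ' • z) + kappaSL γ' z := by
  have h := kappa_mul_apply (Matrix.SpecialLinearGroup.mapGL ℝ γ)
    (Matrix.SpecialLinearGroup.mapGL ℝ γ') (by simp) z
  rw [← map_mul, Matrix.SpecialLinearGroup.det_mapGL, Units.val_one, Complex.ofReal_one,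
    one_div] at h
  exact h

theorem denom_mul_SL (γ γ' : SL(2, ℤ)) (z : ℍ) :
    denom ((γ * γ' : SL(2, ℤ)) : GL (Fin 2) ℝ) z = denom γ (γ' • z : ℍ) * denom γ' z := by
  have h := denom_mul (g := Matrix.SpecialLinearGroup.mapGL ℝ γ)
    (h := Matrix.SpecialLinearGroup.mapGL ℝ γ') (by simp) z
  rw [← map_mul] at h
  exact h

theorem eisG2_slash (γ : SL(2, ℤ)) : eisG2 ∣[(2 : ℤ)] γ = eisG2 + uG • kappaSL γ := by
  rw [eisG2_eq, ModularForm.SL_smul_slash, E2_slash_SL, smul_add, smul_smul]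
  congr 2
  rw [uG]
  have := ofReal_pi_ne_zero
  field_simp
  norm_num

theorem eisG2_smul (γ : SL(2, ℤ)) (z : ℍ) :
    eisG2 (γ • z) = (denom γ z) ^ 2 * (eisG2 z + uG * kappaSL γ z) := by
  have h := congrFun (eisG2_slash γ) z
  rw [ModularForm.SL_slash_apply] at h
  simp only [Pi.add_apply, Pi.smul_apply, smul_eq_mul] at h
  rw [← h, mul_comm, mul_assoc, zpow_neg, ← zpow_natCast]
  have := zpow_ne_zero 2 (denom_ne_zero γ z)
  push_cast
  rw [inv_mul_cancel₀ this, mul_one]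

theorem apply_smul_of_slash_eq {k : ℤ} {f : ℍ → ℂ} {γ : SL(2, ℤ)} (h : f ∣[k] γ = f) (z : ℍ) :
    f (γ • z) = denom γ z ^ k * f z := by
  have := congrFun h z
  rw [ModularForm.SL_slash_apply] at this
  rw [← this, mul_comm, mul_assoc, ← zpow_add₀ (denom_ne_zero γ z)]
  simp

theorem mdiff_eisG2 : MDiff eisG2 := by
  rw [eisG2_eq]
  exact E2_mdifferentiable.const_smul _

theorem isBoundedAtImInfty_eisG2 : IsBoundedAtImInfty eisG2 := by
  rw [eisG2_eq]
  exact isBoundedAtImInfty_const_smul _ EisensteinSeries.isBoundedAtImInfty_E2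

/-- An element of `Γ(N)` with prescribed lower row `(N t, N² t m + 1)`. -/
def gammaElt (N : ℕ) (t m : ℤ) : SL(2, ℤ) :=
  ⟨!![1, N * m; N * t, N * t * (N * m) + 1], by rw [Matrix.det_fin_two_of]; ring⟩

theorem gammaElt_mem (N : ℕ) (t m : ℤ) : gammaElt N t m ∈ Gamma N := by
  rw [Gamma_mem]
  refine ⟨?_, ?_, ?_, ?_⟩ <;> simp [gammaElt]

/-! ### Algebraic independence of `G₂` -/

/-- A finite double power sum vanishing identically has zero coefficients. -/
theorem coeff_eq_zero_of_sum_pow {s : Finset (ℕ × ℕ)} {A : ℕ × ℕ → ℂ}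
    (h : ∀ U w : ℂ, ∑ p ∈ s, A p * U ^ (p.2 + p.1) * w ^ p.1 = 0) : ∀ p ∈ s, A p = 0 := by
  intro q hq
  -- Powers of `w` separate the values of `p.1`; with `p.1` fixed, powers of `U` then separate the
  -- values of `p.2`.
  have h1 : ∀ U : ℂ, ∑ p ∈ s, (if p.1 = q.1 then A p else 0) * U ^ (p.2 + p.1) = 0 := by
    intro U
    have hp : ∑ p ∈ s, Polynomial.C (A p * U ^ (p.2 + p.1)) * Polynomial.X ^ p.1 = 0 :=
      Polynomial.funext fun w => by simpa [Polynomial.eval_finsetSum] using h U w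
    have := congrArg (fun P => Polynomial.coeff P q.1) hp
    simp only [Polynomial.finsetSum_coeff, Polynomial.coeff_C_mul_X_pow,
      Polynomial.coeff_zero] at this
    refine (Finset.sum_congr rfl fun p _ => ?_).trans this
    by_cases e : p.1 = q.1
    · simp [e]
    · simp [e, Ne.symm e]
  have hp : ∑ p ∈ s, Polynomial.C (if p.1 = q.1 then A p else 0) *
      Polynomial.X ^ (p.2 + p.1) = 0 :=
    Polynomial.funext fun U => by simpa [Polynomial.eval_finsetSum] using h1 U
  have := congrArg (fun P => Polynomial.coeff P (q.2 + q.1)) hp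
  simp only [Polynomial.finsetSum_coeff, Polynomial.coeff_C_mul_X_pow,
    Polynomial.coeff_zero] at this
  rw [Finset.sum_eq_single_of_mem q hq] at this
  · simpa using this
  · intro p _ hpq
    by_cases e : p.1 = q.1
    · by_cases e' : q.2 + q.1 = p.2 + p.1
      · exact absurd (Prod.ext e (by omega)) hpq
      · simp [e']
    · simp [e]

/-- Polynomials in the lower row of `Γ(N)` that vanish on `Γ(N)` vanish identically. -/
theorem vanish_of_vanish_Gamma {N : ℕ} (hN : 0 < N) {s : Finset (ℕ × ℕ)} {A : ℕ × ℕ → ℂ}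
    {z φ u : ℂ} (h : ∀ γ ∈ Gamma N, ∑ p ∈ s, A p * ((γ 1 0 : ℂ) * z + γ 1 1) ^ (p.2 + p.1) *
      (((γ 1 0 : ℂ) * z + γ 1 1) * φ + u * γ 1 0) ^ p.1 = 0) (x y : ℂ) :
    ∑ p ∈ s, A p * (x * z + y) ^ (p.2 + p.1) * ((x * z + y) * φ + u * x) ^ p.1 = 0 := by
  have hN' : (N : ℂ) ≠ 0 := by exact_mod_cast hN.ne'
  -- For a fixed left entry `c = N(t+1)` the right entry takes infinitely many values `cNm + 1`, so
  -- it may be freed. The shift to `t + 1` excludes `c = 0`, for which these values coincide. The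
  -- entry `c` is freed next in the same way.
  have h1 : ∀ (t : ℕ) (y : ℂ), ∑ p ∈ s, A p * (((N * (t + 1) : ℕ) : ℂ) * z + y) ^ (p.2 + p.1) *
      ((((N * (t + 1) : ℕ) : ℂ) * z + y) * φ + u * ((N * (t + 1) : ℕ) : ℂ)) ^ p.1 = 0 := by
    intro t y
    set c : ℂ := ((N * (t + 1) : ℕ) : ℂ) with hc
    have hc0 : c ≠ 0 := by
      rw [hc]
      exact_mod_cast (Nat.mul_pos hN t.succ_pos).ne'
    let P : Polynomial ℂ := ∑ p ∈ s, Polynomial.C (A p) *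
      (Polynomial.C (c * z) + Polynomial.X) ^ (p.2 + p.1) *
      ((Polynomial.C (c * z) + Polynomial.X) * Polynomial.C φ + Polynomial.C (u * c)) ^ p.1
    have hP : P = 0 := by
      refine Polynomial.eq_zero_of_infinite_isRoot P
        (Set.infinite_of_injective_forall_mem (f := fun m : ℕ => c * (N * m) + 1) ?_ ?_)
      · intro m m' hm
        simpa [hc0, hN'] using hm
      · intro m
        have := h _ (gammaElt_mem N (t + 1) m)
        simp only [gammaElt] at this
        simpa [Polynomial.IsRoot, P, Polynomial.eval_finsetSum, hc] using this
    have := congrArg (Polynomial.eval y) hP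
    simpa [P, Polynomial.eval_finsetSum] using this
  let P : Polynomial ℂ := ∑ p ∈ s, Polynomial.C (A p) *
    (Polynomial.C z * Polynomial.X + Polynomial.C y) ^ (p.2 + p.1) *
    ((Polynomial.C z * Polynomial.X + Polynomial.C y) * Polynomial.C φ +
      Polynomial.C u * Polynomial.X) ^ p.1
  have hP : P = 0 := by
    refine Polynomial.eq_zero_of_infinite_isRoot P
      (Set.infinite_of_injective_forall_mem (f := fun t : ℕ => ((N * (t + 1) : ℕ) : ℂ)) ?_ ?_)
    · intro t t' ht
      simpa [hN'] using ht
    · intro t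
      simpa [Polynomial.IsRoot, P, Polynomial.eval_finsetSum, mul_comm z] using h1 t y
  have := congrArg (Polynomial.eval x) hP
  simpa [P, Polynomial.eval_finsetSum, mul_comm z] using this

theorem evalWith_of (T : ∀ k, modularTower k →ₗ[ℂ] (ℍ → ℂ)) (p : ℕ × ℕ) (a : modularTower p.2) :
    evalWith T (DirectSum.lof ℂ (ℕ × ℕ) (fun p => modularTower p.2) p a) =
      T p.2 a * eisG2 ^ p.1 := by
  rw [evalWith, DirectSum.toModule_lof]
  rfl

open Classical in
theorem evalWith_eq_sum (T : ∀ k, modularTower k →ₗ[ℂ] (ℍ → ℂ)) (a : Coeffs) :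
    evalWith T a = ∑ p ∈ DFinsupp.support a, T p.2 (a p) * eisG2 ^ p.1 := by
  conv_lhs => rw [← DirectSum.sum_support_of a, map_sum]
  exact Finset.sum_congr rfl fun p _ => evalWith_of T p (a p)

theorem exists_common_level {s : Finset (ℕ × ℕ)} (a : ∀ p : ℕ × ℕ, modularTower p.2) :
    ∃ N : ℕ, 0 < N ∧ ∀ p ∈ s, ∀ γ ∈ Gamma N, (a p : ℍ → ℂ) ∣[(p.2 : ℤ)] γ = a p := by
  choose n hn h using fun p => (mem_modularTower_iff.mp (a p).2).2.1
  exact ⟨∏ p ∈ s, n p, Finset.prod_pos fun p _ => hn p, fun p hp γ hγ =>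
    h p γ (Gamma_le_of_dvd (Finset.dvd_prod_of_mem n hp) hγ)⟩

/-- `G₂` is algebraically independent over the tower of modular forms. -/
theorem ker_evalWith : LinearMap.ker (evalWith fun k => (modularTower k).subtype) = ⊥ := by
  classical
  rw [LinearMap.ker_eq_bot']
  intro a ha
  rw [evalWith_eq_sum] at ha
  set s := DFinsupp.support a
  obtain ⟨N, hN, hlev⟩ := exists_common_level (s := s) a
  have hz : ∀ (z : ℍ), ∀ p ∈ s, (a p : ℍ → ℂ) z = 0 := by
    intro z
    -- The relation is evaluated at `γz`: with `j = cz + d`, each `a_p` acquires `j^k` and `G₂`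
    -- becomes `j (j G₂ + u c)`, so for fixed `z` it is polynomial in `(c, d)`.
    have h1 : ∀ γ ∈ Gamma N, ∑ p ∈ s, (a p : ℍ → ℂ) z *
        ((γ 1 0 : ℂ) * z + γ 1 1) ^ (p.2 + p.1) *
        (((γ 1 0 : ℂ) * z + γ 1 1) * eisG2 z + uG * γ 1 0) ^ p.1 = 0 := by
      intro γ hγ
      have h2 := congrFun ha (γ • z)
      simp only [Finset.sum_apply, Pi.mul_apply, Pi.pow_apply, Submodule.subtype_apply,
        Pi.zero_apply] at h2
      rw [← h2]
      refine Finset.sum_congr rfl fun p hp => ?_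
      rw [apply_smul_of_slash_eq (hlev p hp γ hγ), eisG2_smul, kappaSL_apply, ← denom_SL,
        zpow_natCast]
      have hd := denom_ne_zero γ z
      have e : denom γ z ^ 2 * (eisG2 z + uG * (((γ 1 0 : ℤ) : ℂ) / denom γ z)) =
          denom γ z * (denom γ z * eisG2 z + uG * γ 1 0) := by
        field_simp
      rw [e, mul_pow, pow_add]
      ring
    -- Since `u ≠ 0`, the linear forms `xz + y` and `(xz + y) G₂(z) + u x` in `(x, y)` are
    -- independent; the chosen `x`, `y` give them the values `U` and `w`.
    refine coeff_eq_zero_of_sum_pow fun U w => ?_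
    have h3 := vanish_of_vanish_Gamma hN h1 ((w - U * eisG2 z) / uG)
      (U - (w - U * eisG2 z) / uG * z)
    have h4 := uG_ne_zero
    have e1 : (w - U * eisG2 z) / uG * z + (U - (w - U * eisG2 z) / uG * z) = U := by ring
    have e2 : U * eisG2 z + uG * ((w - U * eisG2 z) / uG) = w := by
      field_simp
      ring
    simpa only [e1, e2] using h3
  refine DFinsupp.ext fun p => ?_
  by_cases hp : p ∈ s
  · exact Subtype.ext (funext fun z => hz z p hp)
  · exact DFinsupp.notMem_support_iff.mp hp

theorem coeffs_evalWith (a : Coeffs) :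
    coeffs (evalWith (fun k => (modularTower k).subtype) a) = a :=
  LinearMap.leftInverse_apply_of_inj ker_evalWith a

/-- The computation rule for `extend`: by uniqueness of the expansion, `coeffs` recovers the single
coefficient `a`. Later arguments need only this, not the choice of left inverse. -/
theorem extend_mul_pow (T : ∀ k, modularTower k →ₗ[ℂ] (ℍ → ℂ)) {k : ℕ} (a : modularTower k)
    (i : ℕ) : extend T ((a : ℍ → ℂ) * eisG2 ^ i) = T k a * eisG2 ^ i := by
  have h := evalWith_of (fun k => (modularTower k).subtype) (i, k) a
  simp only [Submodule.subtype_apply] at h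
  rw [← h, extend, LinearMap.comp_apply, coeffs_evalWith, evalWith_of]

/-! ### The products `a G₂^i` are quasimodular -/

theorem mul_pow_slash_SL (k : ℤ) (f g : ℍ → ℂ) (n : ℕ) (α : SL(2, ℤ)) :
    (f * g ^ n) ∣[k + 2 * n] α = f ∣[k] α * (g ∣[(2 : ℤ)] α) ^ n := by
  ext z
  have hd := denom_ne_zero α z
  have e : denom α z ^ (-(k + 2 * n)) = denom α z ^ (-k) * (denom α z ^ (-2 : ℤ)) ^ n := by
    rw [← zpow_natCast, ← zpow_mul, ← zpow_add₀ hd]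
    congr 1
    ring
  simp only [Pi.mul_apply, Pi.pow_apply, ModularForm.SL_slash_apply, e]
  ring

/-- Because `|cz + d| ≥ |c| Im z`. -/
theorem isBoundedAtImInfty_kappaSL (γ : SL(2, ℤ)) : IsBoundedAtImInfty (kappaSL γ) := by
  rw [isBoundedAtImInfty_iff]
  refine ⟨1, 1, fun z hz => ?_⟩
  rw [kappaSL_apply, norm_div, div_le_one (norm_pos_iff.mpr (denom_ne_zero γ z))]
  refine le_trans ?_ (Complex.abs_im_le_norm _)
  rw [denom_SL]
  have h : ((γ 1 0 : ℂ) * z + γ 1 1).im = (γ 1 0 : ℝ) * z.im := by simp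
  rw [h, abs_mul, Complex.norm_intCast, abs_of_pos z.im_pos]
  exact le_mul_of_one_le_right (abs_nonneg _) hz

theorem isBoundedAtImInfty_pow {f : ℍ → ℂ} (h : IsBoundedAtImInfty f) (n : ℕ) :
    IsBoundedAtImInfty (f ^ n) := by
  induction n with
  | zero => rw [pow_zero]; exact Filter.const_boundedAtFilter _ (1 : ℂ)
  | succ n ih => rw [pow_succ]; exact Filter.BoundedAtFilter.mul ih h

theorem isBoundedAtImInfty_sum {ι : Type*} (s : Finset ι) {f : ι → ℍ → ℂ}
    (h : ∀ i ∈ s, IsBoundedAtImInfty (f i)) : IsBoundedAtImInfty (∑ i ∈ s, f i) := by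
  classical
  induction s using Finset.induction_on with
  | empty => rw [Finset.sum_empty]; exact Filter.const_boundedAtFilter _ (0 : ℂ)
  | insert a s ha ih =>
    rw [Finset.sum_insert ha]
    exact Filter.BoundedAtFilter.add (h a (Finset.mem_insert_self a s))
      (ih fun i hi => h i (Finset.mem_insert_of_mem hi))

theorem isBoundedAtImInfty_eisG2_slash (α : SL(2, ℤ)) :
    IsBoundedAtImInfty (eisG2 ∣[(2 : ℤ)] α) := by
  rw [eisG2_slash]
  exact Filter.BoundedAtFilter.add isBoundedAtImInfty_eisG2
    (isBoundedAtImInfty_const_smul _ (isBoundedAtImInfty_kappaSL α))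

theorem mdiff_pow {f : ℍ → ℂ} (h : MDiff f) (n : ℕ) : MDiff (f ^ n) := by
  induction n with
  | zero => rw [pow_zero]; exact mdifferentiable_const
  | succ n ih => rw [pow_succ]; exact ih.mul h

theorem mdiff_sum {ι : Type*} (s : Finset ι) {f : ι → ℍ → ℂ}
    (h : ∀ i ∈ s, MDiff (f i)) : MDiff (∑ i ∈ s, f i) := by
  classical
  induction s using Finset.induction_on with
  | empty => rw [Finset.sum_empty]; exact mdifferentiable_const
  | insert a s ha ih =>
    rw [Finset.sum_insert ha]
    exact (h a (Finset.mem_insert_self a s)).add (ih fun i hi => h i (Finset.mem_insert_of_mem hi))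

/-- The binomial expansion of `a (G₂ + u κ)^i` exhibits depth `i`, with top coefficient `u^i a`. The
case `a = 0` is separate, since the top coefficient has to be nonzero. -/
theorem mul_eisG2_pow_mem_QM {k : ℕ} {a : ℍ → ℂ} (ha : a ∈ modularTower k) (i : ℕ) :
    a * eisG2 ^ i ∈ QM := by
  by_cases h0 : a = 0
  · rw [h0, zero_mul]
    exact QM.zero_mem
  rw [mem_modularTower_iff] at ha
  obtain ⟨a1, ⟨N, hN, a2⟩, a3⟩ := ha
  refine Submodule.subset_span ⟨N, k + 2 * i, i, hN, Or.inr ⟨a1.mul (mdiff_pow mdiff_eisG2 i),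
    fun j => ((i.choose j : ℂ) * uG ^ j) • (a * eisG2 ^ (i - j)), fun j _ => ?_, ?_, ?_, ?_⟩⟩
  · exact (a1.mul (mdiff_pow mdiff_eisG2 _)).const_smul _
  · simp [h0, uG_ne_zero]
  · intro γ hγ z
    have h1 := congrFun (mul_pow_slash_SL k a eisG2 i γ) z
    rw [a2 γ hγ, eisG2_slash, ModularForm.SL_slash_apply, mul_comm] at h1
    push_cast
    rw [h1, Pi.mul_apply, Pi.pow_apply, Pi.add_apply, add_comm, add_pow, Finset.mul_sum]
    refine Finset.sum_congr rfl fun j _ => ?_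
    rw [← kappaSL_apply]
    simp only [Pi.smul_apply, Pi.mul_apply, Pi.pow_apply, smul_eq_mul]
    ring
  · intro j hj α
    have e : (((k + 2 * i : ℕ) : ℤ) - 2 * j) = k + 2 * ((i - j : ℕ) : ℤ) := by
      push_cast [Nat.cast_sub hj]
      ring
    rw [ModularForm.SL_smul_slash, e, mul_pow_slash_SL]
    exact isBoundedAtImInfty_const_smul _ (Filter.BoundedAtFilter.mul (a3 α)
      (isBoundedAtImInfty_pow (isBoundedAtImInfty_eisG2_slash α) _))

/-! ### Every quasimodular form is a polynomial in `G₂` -/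

open Polynomial in
/-- The polynomial `∑ f_j(z) T^j` of a quasimodular form. -/
def qmPoly (g : ℕ → ℍ → ℂ) (s : ℕ) (z : ℍ) : ℂ[X] :=
  ∑ j ∈ Finset.range (s + 1), C (g j z) * X ^ j

/-- The functions `φ = u⁻¹ G₂` with `φ|γ = φ + c / (c z + d)`. -/
def phiG (z : ℍ) : ℂ := uG⁻¹ * eisG2 z

theorem phiG_smul (γ : SL(2, ℤ)) (z : ℍ) :
    phiG (γ • z) = (denom γ z) ^ 2 * (phiG z + kappaSL γ z) := by
  rw [phiG, eisG2_smul, phiG]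
  have := uG_ne_zero
  field_simp

/-- The coefficients of `∑ f_j(z) (T - φ(z))^j`. -/
def qmCoeff (g : ℕ → ℍ → ℂ) (s i : ℕ) : ℍ → ℂ :=
  ∑ j ∈ Finset.range (s + 1), (j.choose i : ℂ) • (g j * (-phiG) ^ (j - i))

open Polynomial in
theorem qmCoeff_eq (g : ℕ → ℍ → ℂ) (s i : ℕ) (z : ℍ) :
    qmCoeff g s i z = ((qmPoly g s z).comp (X + C (-phiG z))).coeff i := by
  simp only [qmCoeff, qmPoly, Finset.sum_apply, Pi.smul_apply, Pi.mul_apply, Pi.pow_apply,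
    Pi.neg_apply, Polynomial.sum_comp, mul_comp, pow_comp, X_comp, C_comp,
    Polynomial.finsetSum_coeff, coeff_C_mul, coeff_X_add_C_pow, smul_eq_mul]
  exact Finset.sum_congr rfl fun j _ => by ring

-- `f(z)` is the constant term of `P_z`, that is, the value of `P_z(T - φ(z))` at `T = φ(z)`.
open Polynomial in
theorem qmPoly_eq_sum (g : ℕ → ℍ → ℂ) (s : ℕ) (z : ℍ) :
    (qmPoly g s z).eval 0 = ∑ i ∈ Finset.range (s + 1), qmCoeff g s i z * phiG z ^ i := by
  have h1 : (qmPoly g s z).eval 0 =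
      ((qmPoly g s z).comp (X + C (-phiG z))).eval (phiG z) := by simp
  have h2 : (qmPoly g s z).natDegree < s + 1 := by
    rw [Nat.lt_succ_iff]
    refine natDegree_sum_le_of_forall_le _ _ fun j hj => ?_
    exact (natDegree_C_mul_X_pow_le _ _).trans (Nat.lt_succ_iff.mp (Finset.mem_range.mp hj))
  rw [h1, eval_eq_sum_range' (n := s + 1)]
  · simp only [qmCoeff_eq]
  · rw [natDegree_comp, natDegree_X_add_C, mul_one]
    exact h2

section

variable {N k s : ℕ} {f : ℍ → ℂ} {g : ℕ → ℍ → ℂ}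

/-- The transformation law of a quasimodular form. -/
def QMTransform (N k s : ℕ) (f : ℍ → ℂ) (g : ℕ → ℍ → ℂ) : Prop :=
  ∀ γ ∈ Gamma N, ∀ z : ℍ, (denom γ z) ^ (-(k : ℤ)) * f (γ • z) =
    ∑ j ∈ Finset.range (s + 1), g j z * (((γ 1 0 : ℤ) : ℂ) / denom γ z) ^ j

theorem qmPoly_eval (h : QMTransform N k s f g) {γ : SL(2, ℤ)} (hγ : γ ∈ Gamma N) (z : ℍ) :
    (qmPoly g s z).eval (kappaSL γ z) = (denom γ z) ^ (-(k : ℤ)) * f (γ • z) := by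
  rw [h γ hγ z, qmPoly, Polynomial.eval_finsetSum, kappaSL_apply]
  simp

theorem qmPoly_eval_zero (h : QMTransform N k s f g) (z : ℍ) : (qmPoly g s z).eval 0 = f z := by
  have h1 := qmPoly_eval h (Gamma N).one_mem z
  rw [kappaSL_apply] at h1
  simpa using h1

-- For `γ' ∈ Γ(N)`, expanding `f(γ'γz)` at `γz` and at `z` shows that both sides agree at `T =
-- κ_{γ'}(γz)`. Matrices `γ'` with lower row `(Nt, 1)` supply infinitely many such points.
open Polynomial in
theorem qmPoly_smul (h : QMTransform N k s f g) (hN : 0 < N) {γ : SL(2, ℤ)} (hγ : γ ∈ Gamma N) (z : ℍ) :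
    qmPoly g s (γ • z) = C (denom γ z ^ (k : ℤ)) *
      (qmPoly g s z).comp (C ((denom γ z ^ 2)⁻¹) * X + C (kappaSL γ z)) := by
  have hN' : (N : ℂ) ≠ 0 := by exact_mod_cast hN.ne'
  refine Polynomial.eq_of_infinite_eval_eq _ _ (Set.infinite_of_injective_forall_mem
    (f := fun t : ℕ => kappaSL (gammaElt N t 0) (γ • z)) ?_ ?_)
  · intro t t' ht
    have hd : ∀ t : ℕ, denom (gammaElt N t 0) (γ • z : ℍ) = N * t * (γ • z : ℍ) + 1 := by
      intro t
      rw [denom_SL]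
      simp [gammaElt]
    have h1 := denom_ne_zero (gammaElt N t 0) (γ • z)
    have h2 := denom_ne_zero (gammaElt N t' 0) (γ • z)
    simp only [kappaSL_apply] at ht
    rw [div_eq_div_iff h1 h2, hd, hd] at ht
    have e : ∀ t : ℕ, (((gammaElt N t 0) 1 0 : ℤ) : ℂ) = N * t := by
      intro t
      simp [gammaElt]
    rw [e, e] at ht
    have h3 : (N : ℂ) * t = N * t' := by linear_combination ht
    exact_mod_cast mul_left_cancel₀ hN' h3
  · intro t
    have hd := denom_ne_zero γ z
    have h1 := qmPoly_eval h (gammaElt_mem N t 0) (γ • z)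
    have h2 := qmPoly_eval h ((Gamma N).mul_mem (gammaElt_mem N t 0) hγ) z
    rw [kappaSL_mul, denom_mul_SL, mul_zpow, mul_smul] at h2
    simp only [Set.mem_ofPred_eq, eval_mul, eval_comp, eval_add, eval_C, eval_X]
    rw [h1, h2, zpow_neg (denom γ z)]
    have := zpow_ne_zero (k : ℤ) hd
    field_simp

/-- The shift by `φ` absorbs the translation by `κ_γ` in `qmPoly_smul`, as `φ(γz) = j²(φ + κ_γ)`
with `j = cz + d`. Only the scaling `T ↦ j⁻² T` and the factor `j^k` remain, so the `i`-th
coefficient has weight `k - 2i`. -/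
theorem qmCoeff_slash (h : QMTransform N k s f g) (hN : 0 < N) {γ : SL(2, ℤ)} (hγ : γ ∈ Gamma N) (i : ℕ) :
    qmCoeff g s i ∣[(k : ℤ) - 2 * i] γ = qmCoeff g s i := by
  ext z
  have hd := denom_ne_zero γ z
  rw [ModularForm.SL_slash_apply, qmCoeff_eq, qmCoeff_eq, qmPoly_smul h hN hγ, phiG_smul]
  have e : (Polynomial.C (denom γ z ^ (k : ℤ)) * (qmPoly g s z).comp
      (Polynomial.C ((denom γ z ^ 2)⁻¹) * Polynomial.X + Polynomial.C (kappaSL γ z))).comp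
        (Polynomial.X + Polynomial.C (-(denom γ z ^ 2 * (phiG z + kappaSL γ z)))) =
      Polynomial.C (denom γ z ^ (k : ℤ)) *
        ((qmPoly g s z).comp (Polynomial.X + Polynomial.C (-phiG z))).comp
          (Polynomial.C ((denom γ z ^ 2)⁻¹) * Polynomial.X) := by
    rw [Polynomial.mul_comp, Polynomial.C_comp, Polynomial.comp_assoc, Polynomial.comp_assoc]
    congr 2
    simp only [Polynomial.add_comp, Polynomial.mul_comp, Polynomial.C_comp, Polynomial.X_comp,
      mul_add, ← Polynomial.C_mul, add_assoc, ← Polynomial.C_add]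
    congr 2
    field_simp
    ring
  rw [e, Polynomial.coeff_C_mul, Polynomial.comp_C_mul_X_coeff, mul_comm, neg_sub,
    zpow_sub₀ hd, inv_pow, ← pow_mul, mul_comm (2 : ℤ), zpow_mul, zpow_natCast, zpow_natCast]
  have h1 := pow_ne_zero k hd
  have h2 := pow_ne_zero i hd
  field_simp
  ring

end

theorem mdiff_phiG : MDiff phiG := mdiff_eisG2.const_smul uG⁻¹

theorem isBoundedAtImInfty_phiG_slash (α : SL(2, ℤ)) :
    IsBoundedAtImInfty ((-phiG) ∣[(2 : ℤ)] α) := by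
  have e : -phiG = (-uG⁻¹) • eisG2 := by
    ext z
    simp [phiG]
  rw [e, ModularForm.SL_smul_slash]
  exact isBoundedAtImInfty_const_smul _ (isBoundedAtImInfty_eisG2_slash α)

theorem isBoundedAtImInfty_qmCoeff_slash {k s : ℕ} {g : ℕ → ℍ → ℂ}
    (h : ∀ j ≤ s, ∀ α : SL(2, ℤ), IsBoundedAtImInfty (g j ∣[((k : ℤ) - 2 * j)] α)) (i : ℕ)
    (α : SL(2, ℤ)) : IsBoundedAtImInfty (qmCoeff g s i ∣[(k : ℤ) - 2 * i] α) := by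
  rw [qmCoeff, SlashAction.sum_slash]
  refine isBoundedAtImInfty_sum _ fun j hj => ?_
  rw [ModularForm.SL_smul_slash]
  by_cases hij : i ≤ j
  · have e : (k : ℤ) - 2 * i = (k : ℤ) - 2 * j + 2 * ((j - i : ℕ) : ℤ) := by
      push_cast [Nat.cast_sub hij]
      ring
    rw [e, mul_pow_slash_SL]
    exact isBoundedAtImInfty_const_smul _ (Filter.BoundedAtFilter.mul
      (h j (Nat.lt_succ_iff.mp (Finset.mem_range.mp hj)) α)
      (isBoundedAtImInfty_pow (isBoundedAtImInfty_phiG_slash α) _))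
  · rw [Nat.choose_eq_zero_of_lt (not_le.mp hij), Nat.cast_zero, zero_smul]
    exact Filter.const_boundedAtFilter _ (0 : ℂ)

/-- The products `a G₂^i` with `a` a modular form. -/
def qmMonomials : Set (ℍ → ℂ) := {f | ∃ k i : ℕ, ∃ a ∈ modularTower k, f = a * eisG2 ^ i}

theorem mem_span_of_isQuasimodularForm {N k s : ℕ} (hN : 0 < N) {f : ℍ → ℂ}
    (hf : IsQuasimodularForm N k s f) : f ∈ Submodule.span ℂ qmMonomials := by
  rcases hf with ⟨rfl, -⟩ | ⟨-, g, hg, -, h, hb⟩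
  · exact Submodule.zero_mem _
  have e : f = ∑ i ∈ Finset.range (s + 1), (uG⁻¹ ^ i) • (qmCoeff g s i * eisG2 ^ i) := by
    ext z
    rw [← qmPoly_eval_zero h z, qmPoly_eq_sum, Finset.sum_apply]
    refine Finset.sum_congr rfl fun i _ => ?_
    simp only [phiG, Pi.smul_apply, Pi.mul_apply, Pi.pow_apply, smul_eq_mul]
    ring
  rw [e]
  refine Submodule.sum_mem _ fun i _ => Submodule.smul_mem _ _ ?_
  have h1 : MDiff (qmCoeff g s i) := mdiff_sum _ fun j hj =>
    ((hg j (Nat.lt_succ_iff.mp (Finset.mem_range.mp hj))).mul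
      (mdiff_pow mdiff_phiG.neg _)).const_smul _
  have h2 := fun γ hγ => qmCoeff_slash h hN (γ := γ) hγ i
  have h3 := isBoundedAtImInfty_qmCoeff_slash hb i
  -- The tower is indexed by weights in `ℕ`; a coefficient of negative weight is zero.
  by_cases hk : (k : ℤ) - 2 * i < 0
  · have : NeZero N := ⟨hN.ne'⟩
    have h4 : qmCoeff g s i = 0 :=
      congrArg (fun F : ModularForm _ _ => (F : ℍ → ℂ))
        (ModularForm.isZero_of_neg_weight hk (mkModularForm hN h1 h2 h3))
    rw [h4, zero_mul]
    exact Submodule.zero_mem _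
  · obtain ⟨l, hl⟩ := Int.eq_ofNat_of_zero_le (not_lt.mp hk)
    refine Submodule.subset_span ⟨l, i, _, mem_modularTower_iff.mpr ?_, rfl⟩
    rw [← hl]
    exact ⟨h1, ⟨N, hN, h2⟩, h3⟩

/-- The structure theorem for quasimodular forms. -/
theorem QM_eq_span : QM = Submodule.span ℂ qmMonomials := by
  refine le_antisymm (Submodule.span_le.mpr ?_) (Submodule.span_le.mpr ?_)
  · rintro f ⟨N, k, s, hN, hf⟩
    exact mem_span_of_isQuasimodularForm hN hf
  · rintro _ ⟨k, i, a, ha, rfl⟩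
    exact mul_eisG2_pow_mem_QM ha i

/-! ### Extending operators from modular to quasimodular forms -/

theorem eq_on_QM {L L' : (ℍ → ℂ) →ₗ[ℂ] (ℍ → ℂ)}
    (h : ∀ (k i : ℕ) (a : modularTower k), L ((a : ℍ → ℂ) * eisG2 ^ i) = L' (a * eisG2 ^ i))
    {f : ℍ → ℂ} (hf : f ∈ QM) : L f = L' f := by
  rw [QM_eq_span] at hf
  refine LinearMap.eqOn_span (f := L) (g := L') ?_ hf
  rintro _ ⟨k, i, a, ha, rfl⟩
  exact h k i ⟨a, ha⟩

theorem map_mem_QM {L : (ℍ → ℂ) →ₗ[ℂ] (ℍ → ℂ)}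
    (h : ∀ (k i : ℕ) (a : modularTower k), L ((a : ℍ → ℂ) * eisG2 ^ i) ∈ QM)
    {f : ℍ → ℂ} (hf : f ∈ QM) : L f ∈ QM := by
  rw [QM_eq_span] at hf
  have : Submodule.span ℂ qmMonomials ≤ QM.comap L := by
    refine Submodule.span_le.mpr ?_
    rintro _ ⟨k, i, a, ha, rfl⟩
    exact h k i ⟨a, ha⟩
  exact this hf

theorem mem_QM_of_mem_modularTower {k : ℕ} {a : ℍ → ℂ} (ha : a ∈ modularTower k) : a ∈ QM := by
  have h := mul_eisG2_pow_mem_QM ha 0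
  rwa [pow_zero, mul_one] at h

theorem mul_mem_QM {f g : ℍ → ℂ} (hf : f ∈ QM) (hg : g ∈ QM) : f * g ∈ QM := by
  refine map_mem_QM (L := LinearMap.mulRight ℂ g) (fun k i a => ?_) hf
  refine map_mem_QM (L := LinearMap.mulLeft ℂ ((a : ℍ → ℂ) * eisG2 ^ i)) (fun l j b => ?_) hg
  rw [LinearMap.mulLeft_apply, mul_mul_mul_comm, ← pow_add]
  exact mul_eisG2_pow_mem_QM (mul_mem_modularTower a.2 b.2) _

section extend

variable {T : ∀ k, modularTower k →ₗ[ℂ] (ℍ → ℂ)}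

theorem extend_mul_pow_of_mem (T : ∀ k, modularTower k →ₗ[ℂ] (ℍ → ℂ)) {k : ℕ} {a : ℍ → ℂ}
    (ha : a ∈ modularTower k) (i : ℕ) : extend T (a * eisG2 ^ i) = T k ⟨a, ha⟩ * eisG2 ^ i :=
  extend_mul_pow T ⟨a, ha⟩ i

theorem extend_mem_QM (w : ℕ → ℕ) (hT : ∀ k (a : modularTower k), T k a ∈ modularTower (w k))
    {f : ℍ → ℂ} (hf : f ∈ QM) : extend T f ∈ QM := by
  refine map_mem_QM (fun k i a => ?_) hf
  rw [extend_mul_pow]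
  exact mul_eisG2_pow_mem_QM (hT k a) i

/-- Multiplicative operators on modular forms extend multiplicatively. -/
theorem extend_mul_of_mul (hT : ∀ k l (a : modularTower k) (b : modularTower l),
      T (k + l) ⟨a * b, mul_mem_modularTower a.2 b.2⟩ = T k a * T l b)
    {f g : ℍ → ℂ} (hf : f ∈ QM) (hg : g ∈ QM) : extend T (f * g) = extend T f * extend T g := by
  refine eq_on_QM (L := extend T ∘ₗ LinearMap.mulRight ℂ g)
    (L' := LinearMap.mulRight ℂ (extend T g) ∘ₗ extend T) (fun k i a => ?_) hf
  refine eq_on_QM (L := extend T ∘ₗ LinearMap.mulLeft ℂ ((a : ℍ → ℂ) * eisG2 ^ i))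
    (L' := LinearMap.mulLeft ℂ (extend T ((a : ℍ → ℂ) * eisG2 ^ i)) ∘ₗ extend T)
    (fun l j b => ?_) hg
  simp only [LinearMap.comp_apply, LinearMap.mulLeft_apply]
  rw [mul_mul_mul_comm, ← pow_add, extend_mul_pow_of_mem T (mul_mem_modularTower a.2 b.2),
    extend_mul_pow, extend_mul_pow, hT, pow_add, mul_mul_mul_comm]

/-- Derivations on modular forms extend to derivations. -/
theorem extend_mul_of_derivation (hT : ∀ k l (a : modularTower k) (b : modularTower l),
      T (k + l) ⟨a * b, mul_mem_modularTower a.2 b.2⟩ = T k a * b + a * T l b)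
    {f g : ℍ → ℂ} (hf : f ∈ QM) (hg : g ∈ QM) :
    extend T (f * g) = extend T f * g + f * extend T g := by
  refine eq_on_QM (L := extend T ∘ₗ LinearMap.mulRight ℂ g)
    (L' := LinearMap.mulRight ℂ g ∘ₗ extend T + LinearMap.mulRight ℂ (extend T g))
    (fun k i a => ?_) hf
  refine eq_on_QM (L := extend T ∘ₗ LinearMap.mulLeft ℂ ((a : ℍ → ℂ) * eisG2 ^ i))
    (L' := LinearMap.mulLeft ℂ (extend T ((a : ℍ → ℂ) * eisG2 ^ i)) +
      LinearMap.mulLeft ℂ ((a : ℍ → ℂ) * eisG2 ^ i) ∘ₗ extend T)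
    (fun l j b => ?_) hg
  simp only [LinearMap.comp_apply, LinearMap.mulLeft_apply, LinearMap.add_apply]
  rw [mul_mul_mul_comm, ← pow_add, extend_mul_pow_of_mem T (mul_mem_modularTower a.2 b.2),
    extend_mul_pow, extend_mul_pow, hT]
  ring

end extend

/-! ### The operators `||α`, `X`, `Y` on quasimodular forms -/

theorem qslash_apply {k : ℕ} {a : ℍ → ℂ} (α : GL(2, ℚ)⁺) (ha : a ∈ modularTower k) (i : ℕ) :
    qslash α (a * eisG2 ^ i) = slash k α a * eisG2 ^ i := extend_mul_pow_of_mem _ ha i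

theorem opX_apply {k : ℕ} {a : ℍ → ℂ} (ha : a ∈ modularTower k) (i : ℕ) :
    opX (a * eisG2 ^ i) = modX k ⟨a, ha⟩ * eisG2 ^ i := extend_mul_pow_of_mem _ ha i

theorem opY_apply {k : ℕ} {a : ℍ → ℂ} (ha : a ∈ modularTower k) (i : ℕ) :
    opY (a * eisG2 ^ i) = ((k : ℂ) / 2) • (a * eisG2 ^ i) := by
  rw [← smul_mul_assoc]
  exact extend_mul_pow_of_mem _ ha i

theorem qslash_mem (α : GL(2, ℚ)⁺) {f : ℍ → ℂ} (hf : f ∈ QM) : qslash α f ∈ QM :=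
  extend_mem_QM id (fun _ a => slash_mem_modularTower α a.2) hf

theorem opX_mem {f : ℍ → ℂ} (hf : f ∈ QM) : opX f ∈ QM :=
  extend_mem_QM (· + 2) modX_mem hf

theorem opY_mem {f : ℍ → ℂ} (hf : f ∈ QM) : opY f ∈ QM :=
  extend_mem_QM id modY_mem hf

theorem qslash_mul (α : GL(2, ℚ)⁺) {f g : ℍ → ℂ} (hf : f ∈ QM) (hg : g ∈ QM) :
    qslash α (f * g) = qslash α f * qslash α g :=
  extend_mul_of_mul (fun k l a b => slash_mul k l α a b) hf hg

theorem opX_mul {f g : ℍ → ℂ} (hf : f ∈ QM) (hg : g ∈ QM) :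
    opX (f * g) = opX f * g + f * opX g := by
  refine extend_mul_of_derivation (fun k l a b => ?_) hf hg
  rw [modX_eq, modX_eq, modX_eq]
  push_cast
  exact Derivative.serreDerivative_mul _ _ _ _ (mdiff_of_mem_modularTower a.2)
    (mdiff_of_mem_modularTower b.2)

theorem opY_mul {f g : ℍ → ℂ} (hf : f ∈ QM) (hg : g ∈ QM) :
    opY (f * g) = opY f * g + f * opY g := by
  refine extend_mul_of_derivation (fun k l a b => ?_) hf hg
  ext z
  simp only [modY, LinearMap.smul_apply, Submodule.subtype_apply, Pi.smul_apply, Pi.mul_apply,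
    Pi.add_apply, smul_eq_mul]
  push_cast
  ring

theorem qslash_qslash (α β : GL(2, ℚ)⁺) {f : ℍ → ℂ} (hf : f ∈ QM) :
    qslash β (qslash α f) = qslash (α * β) f := by
  refine eq_on_QM (L := qslash β ∘ₗ qslash α) (fun k i a => ?_) hf
  rw [LinearMap.comp_apply, qslash_apply _ a.2, qslash_apply _ (slash_mem_modularTower α a.2),
    qslash_apply _ a.2, slash_slash]

theorem qslash_one {f : ℍ → ℂ} (hf : f ∈ QM) : qslash 1 f = f := by
  refine eq_on_QM (L' := LinearMap.id) (fun k i a => ?_) hf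
  rw [qslash_apply _ a.2, slash_one, LinearMap.id_apply]

theorem opY_qslash (α : GL(2, ℚ)⁺) {f : ℍ → ℂ} (hf : f ∈ QM) :
    opY (qslash α f) = qslash α (opY f) := by
  refine eq_on_QM (L := opY ∘ₗ qslash α) (L' := qslash α ∘ₗ opY) (fun k i a => ?_) hf
  rw [LinearMap.comp_apply, LinearMap.comp_apply, qslash_apply _ a.2,
    opY_apply (slash_mem_modularTower α a.2), opY_apply a.2, map_smul, qslash_apply _ a.2]

/-- `X(f || α) = X(f) || α + μ_α Y(f || α)`. -/
theorem opX_qslash (α : GL(2, ℚ)⁺) {f : ℍ → ℂ} (hf : f ∈ QM) :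
    opX (qslash α f) = qslash α (opX f) + mu α * opY (qslash α f) := by
  refine eq_on_QM (L := opX ∘ₗ qslash α)
    (L' := qslash α ∘ₗ opX + LinearMap.mulLeft ℂ (mu α) ∘ₗ opY ∘ₗ qslash α) (fun k i a => ?_) hf
  simp only [LinearMap.comp_apply, LinearMap.add_apply, LinearMap.mulLeft_apply]
  rw [qslash_apply _ a.2, opX_apply (slash_mem_modularTower α a.2), opX_apply a.2,
    qslash_apply _ (modX_mem k a), opY_apply (slash_mem_modularTower α a.2), modX_slash k α a,
    add_mul, ← smul_mul_assoc, ← mul_assoc]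
  rfl

theorem opY_opX {f : ℍ → ℂ} (hf : f ∈ QM) : opY (opX f) = opX (opY f) + opX f := by
  refine eq_on_QM (L := opY ∘ₗ opX) (L' := opX ∘ₗ opY + opX) (fun k i a => ?_) hf
  simp only [LinearMap.comp_apply, LinearMap.add_apply]
  rw [opY_apply a.2, map_smul, opX_apply a.2, opY_apply (modX_mem k a)]
  push_cast
  module

theorem mu_mem_QM (δ : GL(2, ℚ)⁺) : mu δ ∈ QM := mem_QM_of_mem_modularTower (mu_mem δ)

theorem mu_mul_eq_qslash (α β : GL(2, ℚ)⁺) : mu (α * β) = qslash β (mu α) + mu β := by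
  have h := qslash_apply β (mu_mem α) 0
  rw [pow_zero, mul_one, mul_one] at h
  rw [h, mu_mul]

theorem opX_pow_mem {f : ℍ → ℂ} (hf : f ∈ QM) (n : ℕ) : (opX ^ n) f ∈ QM := by
  induction n with
  | zero => exact hf
  | succ n ih =>
    rw [pow_succ', Module.End.mul_apply]
    exact opX_mem ih

theorem opY_mu (δ : GL(2, ℚ)⁺) : opY (mu δ) = mu δ := by
  have h := opY_apply (mu_mem δ) 0
  rw [pow_zero, mul_one] at h
  rw [h]
  simp

/-- `X^n(μ_δ)` has weight `2n + 2`. This is the relation `[Y, δ_{n+1}] = (n+1) δ_{n+1}` on symbols.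
-/
theorem opY_opX_pow_mu (δ : GL(2, ℚ)⁺) (n : ℕ) :
    opY ((opX ^ n) (mu δ)) = ((n : ℂ) + 1) • (opX ^ n) (mu δ) := by
  induction n with
  | zero =>
    rw [pow_zero, Module.End.one_apply, opY_mu]
    simp
  | succ n ih =>
    rw [pow_succ', Module.End.mul_apply, opY_opX (opX_pow_mem (mu_mem_QM δ) n), ih, map_smul]
    push_cast
    module

/-- The correction term in `opX_qslash` vanishes with `μ_γ`; this makes `X` compatible with the
equivariance defining `𝒬_σ`. -/
theorem opX_qslash_SL (γ : SL(2, ℤ)) {f : ℍ → ℂ} (hf : f ∈ QM) :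
    opX (qslash (toGLQ γ) f) = qslash (toGLQ γ) (opX f) := by
  rw [opX_qslash _ hf, mu_toGLQ, zero_mul, add_zero]

theorem opX_pow_qslash_SL (γ : SL(2, ℤ)) {f : ℍ → ℂ} (hf : f ∈ QM) (n : ℕ) :
    (opX ^ n) (qslash (toGLQ γ) f) = qslash (toGLQ γ) ((opX ^ n) f) := by
  induction n with
  | zero => rfl
  | succ n ih =>
    rw [pow_succ', Module.End.mul_apply, Module.End.mul_apply, ih,
      opX_qslash_SL γ (opX_pow_mem hf n)]

/-! ### Sums over `Γ(N) \ GL₂⁺(ℚ)` -/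

section cosets

variable {N : ℕ}

theorem coset_eq_iff {a b : GL(2, ℚ)⁺} : (Quotient.mk _ a : Cosets N) = Quotient.mk _ b ↔
    ∃ γ ∈ Gamma N, b = toGLQ γ * a := by
  rw [Quotient.eq, QuotientGroup.rightRel_apply]
  constructor
  · rintro ⟨γ, hγ, h⟩
    exact ⟨γ, hγ, by rw [h, inv_mul_cancel_right]⟩
  · rintro ⟨γ, hγ, rfl⟩
    exact ⟨γ, hγ, by rw [mul_inv_cancel_right]⟩

theorem exists_out_mk (N : ℕ) (a : GL(2, ℚ)⁺) :
    ∃ γ ∈ Gamma N, a = toGLQ γ * (Quotient.mk _ a : Cosets N).out :=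
  coset_eq_iff.mp (Quotient.out_eq _)

/-- Right translation on the coset space. -/
def cosetMulRight (N : ℕ) (τ : GL(2, ℚ)⁺) : Cosets N ≃ Cosets N :=
  Quotient.congr (Equiv.mulRight τ) fun a b => by
    change QuotientGroup.rightRel (GammaQ N) a b ↔
      QuotientGroup.rightRel (GammaQ N) (a * τ) (b * τ)
    rw [QuotientGroup.rightRel_apply, QuotientGroup.rightRel_apply, mul_inv_rev, mul_assoc,
      mul_inv_cancel_left]

theorem cosetMulRight_mk (τ a : GL(2, ℚ)⁺) :
    cosetMulRight N τ (Quotient.mk _ a) = Quotient.mk _ (a * τ) := rfl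

theorem apply_out {M : Type*} {v : GL(2, ℚ)⁺ → M}
    (hv : ∀ γ ∈ Gamma N, ∀ β, v (toGLQ γ * β) = v β) (a : GL(2, ℚ)⁺) :
    v (Quotient.mk _ a : Cosets N).out = v a := by
  obtain ⟨γ, hγ, h⟩ := exists_out_mk N a
  conv_rhs => rw [h]
  exact (hv γ hγ _).symm

theorem cosetMulRight_out (τ : GL(2, ℚ)⁺) (c : Cosets N) :
    cosetMulRight N τ c = Quotient.mk _ (c.out * τ) := by
  rw [← cosetMulRight_mk, Quotient.out_eq]

/-- Right translation permutes the cosets, and a left-invariant `v` does not see the choice of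
representatives. This is the change of variables behind equivariance and associativity. -/
theorem finsum_out_mul {M : Type*} [AddCommMonoid M] {v : GL(2, ℚ)⁺ → M}
    (hv : ∀ γ ∈ Gamma N, ∀ β, v (toGLQ γ * β) = v β) (τ : GL(2, ℚ)⁺) :
    ∑ᶠ c : Cosets N, v (c.out * τ) = ∑ᶠ c : Cosets N, v c.out := by
  rw [← finsum_comp_equiv (cosetMulRight N τ) (f := fun c => v c.out)]
  refine finsum_congr fun c => ?_
  rw [cosetMulRight_out, apply_out hv]

end cosets

/-! ### The product `F¹ ∗ F²` and its associativity -/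

section Q

variable {N : ℕ} {σ : SL(2, ℤ)} {F G H : GL(2, ℚ)⁺ → ℍ → ℂ}

theorem finite_support_out (hF : F ∈ Q N σ) (τ : GL(2, ℚ)⁺) :
    {c : Cosets N | F (c.out * τ) ≠ 0}.Finite := by
  refine (hF.2.2.1.preimage (f := cosetMulRight N τ) (cosetMulRight N τ).injective.injOn).subset ?_
  intro c hc
  exact ⟨c.out * τ, hc, (cosetMulRight_out τ c).symm⟩

theorem apply_toGLQ_mul (hF : F ∈ Q N σ) {γ : SL(2, ℤ)} (hγ : γ ∈ Gamma N) (α : GL(2, ℚ)⁺) :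
    F (toGLQ γ * α) = F α := hF.2.1 γ hγ α

theorem apply_mul_toGLQ (hF : F ∈ Q N 1) {γ : SL(2, ℤ)} (hγ : γ ∈ Gamma N) (α : GL(2, ℚ)⁺) :
    F (α * toGLQ γ) = qslash (toGLQ γ) (F α) := by
  rw [hF.2.2.2 γ hγ α, one_mul, inv_one, mul_one]

/-- Any finite set containing the support of the left factor may serve, so several products can be
summed over one common set. -/
theorem heckeMul_eq_sum {S : Finset (Cosets N)} (hS : ∀ c : Cosets N, F (c.out * toGLQ σ) ≠ 0 →
    c ∈ S) (α : GL(2, ℚ)⁺) : heckeMul N σ F G α =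
      ∑ c ∈ S, F (c.out * toGLQ σ) * qslash c.out (G (α * (toGLQ σ)⁻¹ * c.out⁻¹)) := by
  refine finsum_eq_sum_of_support_subset _ fun c hc => ?_
  refine hS c fun h0 => hc ?_
  simp only [h0, zero_mul]

/-- Equivariance of `G` turns the `γ⁻¹` in its argument into a slash by `γ⁻¹`, which cancels the `γ`
in the slash by `γβ`. Hence the summand depends only on the coset of `β`. -/
theorem heckeTerm_left (hF : F ∈ Q N σ) (hG : G ∈ Q N 1) (α : GL(2, ℚ)⁺) {γ : SL(2, ℤ)}
    (hγ : γ ∈ Gamma N) (β : GL(2, ℚ)⁺) :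
    F (toGLQ γ * β * toGLQ σ) * qslash (toGLQ γ * β) (G (α * (toGLQ σ)⁻¹ * (toGLQ γ * β)⁻¹)) =
      F (β * toGLQ σ) * qslash β (G (α * (toGLQ σ)⁻¹ * β⁻¹)) := by
  rw [mul_assoc, apply_toGLQ_mul hF hγ, mul_inv_rev, ← map_inv toGLQ γ, ← mul_assoc _ β⁻¹,
    apply_mul_toGLQ hG ((Gamma N).inv_mem hγ), qslash_qslash _ _ (hG.1 _), ← mul_assoc, ← map_mul,
    inv_mul_cancel, map_one, one_mul]

theorem heckeMul_mem (hF : F ∈ Q N σ) (hG : G ∈ Q N 1) : heckeMul N σ F G ∈ Q N σ := by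
  refine ⟨fun α => ?_, fun γ hγ α => ?_, ?_, fun γ hγ α => ?_⟩
  · exact finsum_induction (fun f => f ∈ QM) QM.zero_mem (fun _ _ => QM.add_mem)
      fun c => mul_mem_QM (hF.1 _) (qslash_mem _ (hG.1 _))
  · simp only [heckeMul, mul_assoc, apply_toGLQ_mul hG hγ]
  -- If the value at `α` is nonzero, some `x` has `F x ≠ 0` and `G (α x⁻¹) ≠ 0`, so `α = (α x⁻¹) x`
  -- lies in one of finitely many translates. Passing to the chosen representative of `Γx` costs a
  -- factor `γ`, harmless because the slash by `γ` is invertible.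
  · refine ((hF.2.2.1.biUnion fun c _ => hG.2.2.1.image (cosetMulRight N c.out))).subset ?_
    rintro _ ⟨α, hα, rfl⟩
    obtain ⟨c, hc⟩ : ∃ c : Cosets N,
        F (c.out * toGLQ σ) * qslash c.out (G (α * (toGLQ σ)⁻¹ * c.out⁻¹)) ≠ 0 := by
      by_contra! h
      exact hα ((finsum_congr h).trans finsum_zero)
    have h1 := left_ne_zero_of_mul hc
    have h2 : G (α * (toGLQ σ)⁻¹ * c.out⁻¹) ≠ 0 := fun h0 => hc (by rw [h0, map_zero, mul_zero])
    set x := c.out * toGLQ σ with hx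
    obtain ⟨γ, hγ, hxγ⟩ := exists_out_mk N x
    have h3 : α * (toGLQ σ)⁻¹ * c.out⁻¹ = α * x⁻¹ := by rw [hx, mul_inv_rev, mul_assoc]
    rw [h3] at h2
    refine Set.mem_biUnion (x := (Quotient.mk _ x : Cosets N)) ⟨x, h1, rfl⟩
      ⟨Quotient.mk _ (α * x⁻¹ * toGLQ γ), ⟨_, fun h0 => h2 ?_, rfl⟩, ?_⟩
    · rw [apply_mul_toGLQ hG hγ] at h0
      rw [← qslash_one (hG.1 (α * x⁻¹)), ← map_one toGLQ, ← mul_inv_cancel γ, map_mul,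
        ← qslash_qslash _ _ (hG.1 _), h0, map_zero]
    · rw [cosetMulRight_mk, mul_assoc, ← hxγ, inv_mul_cancel_right]
  · have h1 : qslash (toGLQ (σ * γ * σ⁻¹)) (heckeMul N σ F G α) = ∑ᶠ c : Cosets N,
        qslash (toGLQ (σ * γ * σ⁻¹))
          (F (c.out * toGLQ σ) * qslash c.out (G (α * (toGLQ σ)⁻¹ * c.out⁻¹))) := by
      refine map_finsum _ ((finite_support_out hF (toGLQ σ)).subset fun c hc h0 => hc ?_)
      simp only [h0, zero_mul]
    -- Substitute `β ↦ βσγσ⁻¹`: the argument of `G` loses `γ`, while `F (βσγ)` and the slash by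
    -- `βσγσ⁻¹` both produce the slash by `σγσ⁻¹`.
    rw [h1, heckeMul, ← finsum_out_mul
      (v := fun β => F (β * toGLQ σ) * qslash β (G (α * toGLQ γ * (toGLQ σ)⁻¹ * β⁻¹)))
      (fun γ' hγ' β => heckeTerm_left hF hG (α * toGLQ γ) hγ' β) (toGLQ (σ * γ * σ⁻¹))]
    refine finsum_congr fun c => ?_
    rw [qslash_mul _ (hF.1 _) (qslash_mem _ (hG.1 _)), qslash_qslash _ _ (hG.1 _),
      ← hF.2.2.2 γ hγ]
    congr 2
    · simp only [map_mul, map_inv]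
      group
    · congr 1
      simp only [map_mul, map_inv]
      group

theorem finset_of_support (hF : F ∈ Q N σ) (τ : GL(2, ℚ)⁺) :
    ∃ S : Finset (Cosets N), ∀ c : Cosets N, F (c.out * τ) ≠ 0 → c ∈ S :=
  ⟨(finite_support_out hF τ).toFinset, fun _ hc => (Set.Finite.mem_toFinset _).mpr hc⟩

/-- The product `F¹ ∗ F²` as a bilinear map. -/
def heckeMulHom (N : ℕ) (σ : SL(2, ℤ)) : Q N σ →ₗ[ℂ] Q N 1 →ₗ[ℂ] Q N σ :=
  LinearMap.mk₂ ℂ (fun F G => ⟨heckeMul N σ F.1 G.1, heckeMul_mem F.2 G.2⟩)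
    (fun F F' G => Subtype.ext <| funext fun α => by
      classical
      obtain ⟨S, hS⟩ := finset_of_support F.2 (toGLQ σ)
      obtain ⟨S', hS'⟩ := finset_of_support F'.2 (toGLQ σ)
      have h1 : ∀ c : Cosets N, F.1 (c.out * toGLQ σ) ≠ 0 → c ∈ S ∪ S' := fun c hc =>
        Finset.mem_union_left _ (hS c hc)
      have h2 : ∀ c : Cosets N, F'.1 (c.out * toGLQ σ) ≠ 0 → c ∈ S ∪ S' := fun c hc =>
        Finset.mem_union_right _ (hS' c hc)
      have h3 : ∀ c : Cosets N, (F + F').1 (c.out * toGLQ σ) ≠ 0 → c ∈ S ∪ S' := fun c hc => by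
        by_contra h
        refine hc ?_
        rw [Submodule.coe_add, Pi.add_apply, not_imp_comm.mp (h1 c) h, not_imp_comm.mp (h2 c) h,
          add_zero]
      change heckeMul N σ (F + F').1 G.1 α = heckeMul N σ F.1 G.1 α + heckeMul N σ F'.1 G.1 α
      rw [heckeMul_eq_sum h1, heckeMul_eq_sum h2, heckeMul_eq_sum h3, ← Finset.sum_add_distrib]
      exact Finset.sum_congr rfl fun c _ => by
        rw [Submodule.coe_add, Pi.add_apply, add_mul])
    (fun r F G => Subtype.ext <| funext fun α => by
      obtain ⟨S, h1⟩ := finset_of_support F.2 (toGLQ σ)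
      have h3 : ∀ c : Cosets N, (r • F).1 (c.out * toGLQ σ) ≠ 0 → c ∈ S := fun c hc => by
        by_contra h
        refine hc ?_
        rw [Submodule.coe_smul, Pi.smul_apply, not_imp_comm.mp (h1 c) h, smul_zero]
      change heckeMul N σ (r • F).1 G.1 α = r • heckeMul N σ F.1 G.1 α
      rw [heckeMul_eq_sum h1, heckeMul_eq_sum h3, Finset.smul_sum]
      exact Finset.sum_congr rfl fun c _ => by
        rw [Submodule.coe_smul, Pi.smul_apply, smul_mul_assoc])
    (fun F G G' => Subtype.ext <| funext fun α => by
      obtain ⟨S, h1⟩ := finset_of_support F.2 (toGLQ σ)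
      change heckeMul N σ F.1 (G + G').1 α = heckeMul N σ F.1 G.1 α + heckeMul N σ F.1 G'.1 α
      rw [heckeMul_eq_sum h1, heckeMul_eq_sum h1, heckeMul_eq_sum h1, ← Finset.sum_add_distrib]
      exact Finset.sum_congr rfl fun c _ => by
        rw [Submodule.coe_add, Pi.add_apply, map_add, mul_add])
    (fun r F G => Subtype.ext <| funext fun α => by
      obtain ⟨S, h1⟩ := finset_of_support F.2 (toGLQ σ)
      change heckeMul N σ F.1 (r • G).1 α = r • heckeMul N σ F.1 G.1 α
      rw [heckeMul_eq_sum h1, heckeMul_eq_sum h1, Finset.smul_sum]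
      exact Finset.sum_congr rfl fun c _ => by
        rw [Submodule.coe_smul, Pi.smul_apply, map_smul, mul_smul_comm])

theorem heckeMulHom_apply (F : Q N σ) (G : Q N 1) (α : GL(2, ℚ)⁺) :
    (heckeMulHom N σ F G).1 α = heckeMul N σ F.1 G.1 α := rfl

/-- The product is a right action. -/
theorem heckeMul_assoc (hF : F ∈ Q N σ) (hG : G ∈ Q N 1) (hH : H ∈ Q N 1) (α : GL(2, ℚ)⁺) :
    heckeMul N σ (heckeMul N σ F G) H α = heckeMul N σ F (heckeMul N 1 G H) α := by
  classical
  obtain ⟨S, hS⟩ := finset_of_support hF (toGLQ σ)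
  -- The term of the double sum, with `d` indexing the factor `F` and `β` the slash applied to `H`.
  let W : Cosets N → GL(2, ℚ)⁺ → ℍ → ℂ := fun d β => F (d.out * toGLQ σ) *
    qslash d.out (G (β * d.out⁻¹)) * qslash β (H (α * (toGLQ σ)⁻¹ * β⁻¹))
  have hL : heckeMul N σ (heckeMul N σ F G) H α = ∑ᶠ c : Cosets N, ∑ d ∈ S, W d c.out := by
    refine finsum_congr fun c => ?_
    rw [heckeMul_eq_sum hS, Finset.sum_mul]
    refine Finset.sum_congr rfl fun d _ => ?_
    simp only [W, mul_inv_cancel_right]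
  have hfin : ∀ d ∈ S, (Function.support fun c : Cosets N => W d c.out).Finite := by
    intro d _
    refine (finite_support_out hG d.out⁻¹).subset fun c hc h0 => hc ?_
    simp only [W, h0, map_zero, mul_zero, zero_mul]
  rw [hL, finsum_sum_comm S _ hfin, heckeMul_eq_sum hS]
  refine Finset.sum_congr rfl fun d _ => ?_
  have hW : ∀ γ ∈ Gamma N, ∀ β, W d (toGLQ γ * β) = W d β := by
    intro γ hγ β
    simp only [W]
    rw [mul_assoc (toGLQ γ), apply_toGLQ_mul hG hγ, mul_inv_rev, ← map_inv toGLQ γ, ← mul_assoc _ β⁻¹,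
      apply_mul_toGLQ hH ((Gamma N).inv_mem hγ), qslash_qslash _ _ (hH.1 _), ← mul_assoc,
      ← map_mul, inv_mul_cancel, map_one, one_mul]
  -- Substituting `β ↦ βd` turns the inner sum into the slash by `d` of the sum defining `G ∗ H`.
  rw [← finsum_out_mul hW d.out]
  have hG' : (Function.support fun c : Cosets N => G (c.out * toGLQ 1) *
      qslash c.out (H (α * (toGLQ σ)⁻¹ * d.out⁻¹ * (toGLQ 1)⁻¹ * c.out⁻¹))).Finite := by
    refine (finite_support_out hG (toGLQ 1)).subset fun c hc h0 => hc ?_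
    simp only [h0, zero_mul]
  rw [heckeMul, map_finsum _ hG', mul_finsum' _ _ (hG'.subset fun c hc h0 => hc ?_)]
  · refine finsum_congr fun c => ?_
    rw [qslash_mul _ (hG.1 _) (qslash_mem _ (hH.1 _)), qslash_qslash _ _ (hH.1 _), ← mul_assoc]
    simp only [W, map_one, mul_one, inv_one, mul_inv_cancel, mul_inv_rev, mul_assoc]
  · simp only [h0, map_zero]

end Q

/-! ### The action of `𝓗₁` on twisted Hecke operators -/

section action

variable {N : ℕ} {σ : SL(2, ℤ)}

/-- The operator `F ↦ (α ↦ T_α F_α)` on twisted Hecke operators. -/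
def pointwiseOp (T : GL(2, ℚ)⁺ → Module.End ℂ (ℍ → ℂ)) (h1 : ∀ α, ∀ f ∈ QM, T α f ∈ QM)
    (h2 : ∀ γ ∈ Gamma N, ∀ α, T (toGLQ γ * α) = T α)
    (h3 : ∀ γ ∈ Gamma N, ∀ α, ∀ f ∈ QM, T (α * toGLQ γ) (qslash (toGLQ (σ * γ * σ⁻¹)) f) =
      qslash (toGLQ (σ * γ * σ⁻¹)) (T α f)) : Module.End ℂ (Q N σ) where
  toFun F := ⟨fun α => T α (F.1 α), fun α => h1 α _ (F.2.1 α), fun γ hγ α => by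
      simp only [h2 γ hγ, F.2.2.1 γ hγ],
    F.2.2.2.1.subset (Set.image_mono fun α hα h0 => hα (by simp only [h0, map_zero])),
    fun γ hγ α => by
      simp only
      rw [F.2.2.2.2 γ hγ, h3 γ hγ α _ (F.2.1 α)]⟩
  map_add' F G := Subtype.ext <| funext fun α => map_add (T α) (F.1 α) (G.1 α)
  map_smul' c F := Subtype.ext <| funext fun α => map_smul (T α) c (F.1 α)

theorem mu_toGLQ_mul (γ : SL(2, ℤ)) (α : GL(2, ℚ)⁺) : mu (toGLQ γ * α) = mu α := by
  rw [mu_mul, mu_toGLQ, map_zero, zero_add]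

theorem mu_mul_toGLQ (γ : SL(2, ℤ)) (α : GL(2, ℚ)⁺) :
    mu (α * toGLQ γ) = qslash (toGLQ γ) (mu α) := by
  rw [mu_mul_eq_qslash, mu_toGLQ, add_zero]

variable (N σ)

/-- The action of `X`. -/
def actX : Module.End ℂ (Q N σ) :=
  pointwiseOp (fun _ => opX) (fun _ _ => opX_mem) (fun _ _ _ => rfl)
    fun _ _ _ _ hf => opX_qslash_SL _ hf

/-- The action of `Y`. -/
def actY : Module.End ℂ (Q N σ) :=
  pointwiseOp (fun _ => opY) (fun _ _ => opY_mem) (fun _ _ _ => rfl)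
    fun _ _ _ _ hf => opY_qslash _ hf

/-- The action of `δ_{n+1}`. -/
def actδ (n : ℕ) : Module.End ℂ (Q N σ) :=
  pointwiseOp (fun α => LinearMap.mulLeft ℂ ((opX ^ n) (mu (α * (toGLQ σ)⁻¹))))
    (fun _ _ => mul_mem_QM (opX_pow_mem (mu_mem_QM _) n))
    (fun γ _ α => by rw [mul_assoc, mu_toGLQ_mul])
    fun γ _ α f hf => by
      have e : α * toGLQ γ * (toGLQ σ)⁻¹ =
          α * (toGLQ σ)⁻¹ * toGLQ (σ * γ * σ⁻¹) := by
        simp only [map_mul, map_inv]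
        group
      rw [LinearMap.mulLeft_apply, LinearMap.mulLeft_apply, e, mu_mul_toGLQ,
        opX_pow_qslash_SL _ (mu_mem_QM _), qslash_mul _ (opX_pow_mem (mu_mem_QM _) n) hf]

/-- The defining relations hold pointwise: `X` raises the weight by two, `X` and `Y` are
derivations, `X^n(μ)` is an eigenvector of `Y`, and multiplications by functions commute. -/
theorem exists_act : ∃ A : H1 →ₐ[ℂ] Module.End ℂ (Q N σ),
    A H1.X = actX N σ ∧ A H1.Y = actY N σ ∧ ∀ n, A (H1.δ n) = actδ N σ n := by
  refine H1.exists_lift (actX N σ) (actY N σ) (actδ N σ) ?_ (fun n => ?_) (fun n => ?_) fun k l => ?_ <;>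
    refine LinearMap.ext fun F => Subtype.ext <| funext fun α => ?_
  · change opY (opX (F.1 α)) - opX (opY (F.1 α)) = opX (F.1 α)
    rw [opY_opX (F.2.1 α), add_sub_cancel_left]
  · change opX ((opX ^ n) (mu (α * (toGLQ σ)⁻¹)) * F.1 α) -
      (opX ^ n) (mu (α * (toGLQ σ)⁻¹)) * opX (F.1 α) =
        (opX ^ (n + 1)) (mu (α * (toGLQ σ)⁻¹)) * F.1 α
    rw [opX_mul (opX_pow_mem (mu_mem_QM _) n) (F.2.1 α), add_sub_cancel_right, pow_succ',
      Module.End.mul_apply]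
  · change opY ((opX ^ n) (mu (α * (toGLQ σ)⁻¹)) * F.1 α) -
      (opX ^ n) (mu (α * (toGLQ σ)⁻¹)) * opY (F.1 α) =
        ((n : ℂ) + 1) • ((opX ^ n) (mu (α * (toGLQ σ)⁻¹)) * F.1 α)
    rw [opY_mul (opX_pow_mem (mu_mem_QM _) n) (F.2.1 α), add_sub_cancel_right, opY_opX_pow_mu,
      smul_mul_assoc]
  · exact mul_left_comm _ _ _

/-- The action of `𝓗₁` on twisted Hecke operators. -/
def act : H1 →ₐ[ℂ] Module.End ℂ (Q N σ) := (exists_act N σ).choose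

theorem act_X : act N σ H1.X = actX N σ := (exists_act N σ).choose_spec.1
theorem act_Y : act N σ H1.Y = actY N σ := (exists_act N σ).choose_spec.2.1
theorem act_δ (n : ℕ) : act N σ (H1.δ n) = actδ N σ n := (exists_act N σ).choose_spec.2.2 n

variable {N σ}

theorem actX_apply (F : Q N σ) (α : GL(2, ℚ)⁺) : (actX N σ F).1 α = opX (F.1 α) := rfl

theorem actY_apply (F : Q N σ) (α : GL(2, ℚ)⁺) : (actY N σ F).1 α = opY (F.1 α) := rfl

theorem actδ_apply (n : ℕ) (F : Q N σ) (α : GL(2, ℚ)⁺) :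
    (actδ N σ n F).1 α = (opX ^ n) (mu (α * (toGLQ σ)⁻¹)) * F.1 α := rfl

/-- Leibniz' rule followed by `opX_qslash`. At `βσ` the operator `δ₁` multiplies by `μ_{βσσ⁻¹} =
μ_β`, which is the factor in the correction term. -/
theorem actX_heckeMul (F : Q N σ) (G : Q N 1) : actX N σ (heckeMulHom N σ F G) =
    heckeMulHom N σ (actX N σ F) G + heckeMulHom N σ F (actX N 1 G) +
      heckeMulHom N σ (actδ N σ 0 F) (actY N 1 G) := by
  refine Subtype.ext <| funext fun α => ?_
  obtain ⟨S, hS⟩ := finset_of_support F.2 (toGLQ σ)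
  have hX : ∀ c : Cosets N, (actX N σ F).1 (c.out * toGLQ σ) ≠ 0 → c ∈ S := fun c hc =>
    hS c fun h0 => hc (by rw [actX_apply, h0, map_zero])
  have hδ : ∀ c : Cosets N, (actδ N σ 0 F).1 (c.out * toGLQ σ) ≠ 0 → c ∈ S := fun c hc =>
    hS c fun h0 => hc (by rw [actδ_apply, h0, mul_zero])
  simp only [actX_apply, Submodule.coe_add, Pi.add_apply, heckeMulHom_apply]
  rw [heckeMul_eq_sum hS, heckeMul_eq_sum hX, heckeMul_eq_sum hS, heckeMul_eq_sum hδ, map_sum,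
    ← Finset.sum_add_distrib, ← Finset.sum_add_distrib]
  refine Finset.sum_congr rfl fun c _ => ?_
  rw [opX_mul (F.2.1 _) (qslash_mem _ (G.2.1 _)), opX_qslash _ (G.2.1 _), opY_qslash _ (G.2.1 _),
    actδ_apply, mul_inv_cancel_right, actX_apply, actX_apply, actY_apply, pow_zero,
    Module.End.one_apply]
  ring

theorem actY_heckeMul (F : Q N σ) (G : Q N 1) : actY N σ (heckeMulHom N σ F G) =
    heckeMulHom N σ (actY N σ F) G + heckeMulHom N σ F (actY N 1 G) := by
  refine Subtype.ext <| funext fun α => ?_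
  obtain ⟨S, hS⟩ := finset_of_support F.2 (toGLQ σ)
  have hY : ∀ c : Cosets N, (actY N σ F).1 (c.out * toGLQ σ) ≠ 0 → c ∈ S := fun c hc =>
    hS c fun h0 => hc (by rw [actY_apply, h0, map_zero])
  simp only [actY_apply, Submodule.coe_add, Pi.add_apply, heckeMulHom_apply]
  rw [heckeMul_eq_sum hS, heckeMul_eq_sum hY, heckeMul_eq_sum hS, map_sum,
    ← Finset.sum_add_distrib]
  refine Finset.sum_congr rfl fun c _ => ?_
  rw [opY_mul (F.2.1 _) (qslash_mem _ (G.2.1 _)), opY_qslash _ (G.2.1 _), actY_apply, actY_apply]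

/-- Multiplication by `μ_{ασ⁻¹} = μ_{ασ⁻¹β⁻¹}||β + μ_β` in each summand: the first part acts inside
the slash on `G`, the second on `F`. -/
theorem actδ_heckeMul (F : Q N σ) (G : Q N 1) : actδ N σ 0 (heckeMulHom N σ F G) =
    heckeMulHom N σ (actδ N σ 0 F) G + heckeMulHom N σ F (actδ N 1 0 G) := by
  refine Subtype.ext <| funext fun α => ?_
  obtain ⟨S, hS⟩ := finset_of_support F.2 (toGLQ σ)
  have hδ : ∀ c : Cosets N, (actδ N σ 0 F).1 (c.out * toGLQ σ) ≠ 0 → c ∈ S := fun c hc =>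
    hS c fun h0 => hc (by rw [actδ_apply, h0, mul_zero])
  simp only [Submodule.coe_add, Pi.add_apply, heckeMulHom_apply]
  rw [actδ_apply, heckeMulHom_apply, heckeMul_eq_sum hS, heckeMul_eq_sum hδ, heckeMul_eq_sum hS,
    Finset.mul_sum, ← Finset.sum_add_distrib]
  refine Finset.sum_congr rfl fun c _ => ?_
  have e : mu (α * (toGLQ σ)⁻¹) =
      qslash c.out (mu (α * (toGLQ σ)⁻¹ * c.out⁻¹)) + mu c.out := by
    rw [← mu_mul_eq_qslash, inv_mul_cancel_right]
  simp only [actδ_apply, pow_zero, Module.End.one_apply, mul_inv_cancel_right, map_one, inv_one,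
    mul_one]
  rw [qslash_mul _ (mu_mem_QM _) (G.2.1 _), e]
  ring

/-! ### The Hopf identity -/

/-- The action of `𝓗₁ ⊗ 𝓗₁` on `𝒬_σ ⊗ 𝒬`. -/
def actTensor (N : ℕ) (σ : SL(2, ℤ)) :
    H1 ⊗[ℂ] H1 →ₐ[ℂ] Module.End ℂ (Q N σ ⊗[ℂ] Q N 1) :=
  (Module.endTensorEndAlgHom (R := ℂ) (A := ℂ) (M := Q N σ) (N := Q N 1)).comp
    (Algebra.TensorProduct.map (act N σ) (act N 1))

theorem actTensor_tmul (a b : H1) (F : Q N σ) (G : Q N 1) :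
    actTensor N σ (a ⊗ₜ b) (F ⊗ₜ G) = act N σ a F ⊗ₜ act N 1 b G := rfl

/-- The elements of `𝓗₁` whose action is compatible with the product. -/
def IsCompatible (N : ℕ) (σ : SL(2, ℤ)) (h : H1) : Prop :=
  ∀ t, act N σ h (TensorProduct.lift (heckeMulHom N σ) t) =
    TensorProduct.lift (heckeMulHom N σ) (actTensor N σ (H1.comulHom h) t)

theorem isCompatible_algebraMap (c : ℂ) : IsCompatible N σ (algebraMap ℂ H1 c) := fun t => by
  rw [AlgHom.commutes (act N σ), AlgHom.commutes H1.comulHom, AlgHom.commutes (actTensor N σ),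
    Module.algebraMap_end_apply, Module.algebraMap_end_apply]
  exact (map_smul (TensorProduct.lift (heckeMulHom N σ)) c t).symm

theorem IsCompatible.add {a b : H1} (ha : IsCompatible N σ a) (hb : IsCompatible N σ b) :
    IsCompatible N σ (a + b) := fun t => by
  rw [map_add (act N σ), map_add H1.comulHom, map_add (actTensor N σ), LinearMap.add_apply,
    LinearMap.add_apply, ha t, hb t]
  exact (map_add (TensorProduct.lift (heckeMulHom N σ)) _ _).symm

theorem IsCompatible.mul {a b : H1} (ha : IsCompatible N σ a) (hb : IsCompatible N σ b) :
    IsCompatible N σ (a * b) := fun t => by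
  rw [map_mul (act N σ), map_mul H1.comulHom, map_mul (actTensor N σ), Module.End.mul_apply,
    Module.End.mul_apply, hb t]
  exact ha _

theorem isCompatible_of_tmul {a : H1} (ha : ∀ F G, act N σ a (heckeMulHom N σ F G) =
    TensorProduct.lift (heckeMulHom N σ) (actTensor N σ (H1.comulHom a) (F ⊗ₜ G))) :
    IsCompatible N σ a := by
  intro t
  induction t using TensorProduct.induction_on with
  | zero => simp only [map_zero]
  | add x y hx hy => simp only [map_add, hx, hy]
  | tmul F G => exact ha F G

/-- Stated on the whole tensor product, compatibility is closed under composition, because the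
actions and the coproduct are algebra maps. The compatible elements thus form a subalgebra, and it
suffices to find `X`, `Y`, `δ₁` in it. -/
theorem act_lift (h : H1) : IsCompatible N σ h := by
  let B : Subalgebra ℂ H1 :=
    { carrier := {h | IsCompatible N σ h}
      algebraMap_mem' := isCompatible_algebraMap
      add_mem' := IsCompatible.add
      mul_mem' := IsCompatible.mul }
  refine H1.mem_of_generators B (isCompatible_of_tmul fun F G => ?_)
    (isCompatible_of_tmul fun F G => ?_) (isCompatible_of_tmul fun F G => ?_) h
  · rw [H1.comulHom_X, act_X, actX_heckeMul]
    simp only [map_add, LinearMap.add_apply, actTensor_tmul, TensorProduct.lift.tmul, act_X, act_Y,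
      act_δ, map_one, Module.End.one_apply]
  · rw [H1.comulHom_Y, act_Y, actY_heckeMul]
    simp only [map_add, LinearMap.add_apply, actTensor_tmul, TensorProduct.lift.tmul, act_Y,
      map_one, Module.End.one_apply]
  · rw [H1.comulHom_δ, act_δ, actδ_heckeMul]
    simp only [map_add, LinearMap.add_apply, actTensor_tmul, TensorProduct.lift.tmul,
      act_δ, map_one, Module.End.one_apply]

end action

end QMHecke

end

theorem mainTheorem10 (N : ℕ) (hN : 0 < N) :
    ∃ (mul : ∀ σ : SL(2, ℤ), QMHecke.Q N σ →ₗ[ℂ] QMHecke.Q N 1 →ₗ[ℂ] QMHecke.Q N σ)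
      (act : ∀ σ : SL(2, ℤ), QMHecke.H1 →ₐ[ℂ] Module.End ℂ (QMHecke.Q N σ)),
      -- the product `F¹ ∗ F²` is well defined on `𝒬_σ(Γ) × 𝒬(Γ)` and is a right action of `𝒬(Γ)`
      (∀ (σ : SL(2, ℤ)) (F₁ : QMHecke.Q N σ) (F₂ : QMHecke.Q N 1) (α : GL(2, ℚ)⁺),
        (mul σ F₁ F₂).1 α = QMHecke.heckeMul N σ F₁.1 F₂.1 α) ∧
      (∀ (σ : SL(2, ℤ)) (F₁ : QMHecke.Q N σ) (F₂ F₃ : QMHecke.Q N 1),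
        mul σ (mul σ F₁ F₂) F₃ = mul σ F₁ (mul 1 F₂ F₃)) ∧
      -- the action of the generators; `QMHecke.H1.δ n` is the generator `δ_{n+1}`
      (∀ (σ : SL(2, ℤ)) (F : QMHecke.Q N σ) (α : GL(2, ℚ)⁺),
        (act σ QMHecke.H1.X F).1 α = QMHecke.opX (F.1 α)) ∧
      (∀ (σ : SL(2, ℤ)) (F : QMHecke.Q N σ) (α : GL(2, ℚ)⁺),
        (act σ QMHecke.H1.Y F).1 α = QMHecke.opY (F.1 α)) ∧
      (∀ (σ : SL(2, ℤ)) (n : ℕ) (F : QMHecke.Q N σ) (α : GL(2, ℚ)⁺),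
        (act σ (QMHecke.H1.δ n) F).1 α =
          (QMHecke.opX ^ n) (QMHecke.mu (α * (QMHecke.toGLQ σ)⁻¹)) * F.1 α) ∧
      -- the Hopf action: `h(F¹ ∗ F²) = ∑ h₍₁₎(F¹) ∗ h₍₂₎(F²)`
      (∀ (σ : SL(2, ℤ)) (h : QMHecke.H1) (ι : Type) (s : Finset ι) (h₁ h₂ : ι → QMHecke.H1),
        Coalgebra.comul (R := ℂ) h = ∑ i ∈ s, h₁ i ⊗ₜ[ℂ] h₂ i →
        ∀ (F₁ : QMHecke.Q N σ) (F₂ : QMHecke.Q N 1),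
          act σ h (mul σ F₁ F₂) = ∑ i ∈ s, mul σ (act σ (h₁ i) F₁) (act 1 (h₂ i) F₂)) := by
  refine ⟨QMHecke.heckeMulHom N, QMHecke.act N, fun σ F₁ F₂ α => rfl, fun σ F₁ F₂ F₃ => ?_,
    fun σ F α => ?_, fun σ F α => ?_, fun σ n F α => ?_, fun σ h ι s h₁ h₂ hh F₁ F₂ => ?_⟩
  · exact Subtype.ext <| funext fun α => QMHecke.heckeMul_assoc F₁.2 F₂.2 F₃.2 α
  · rw [QMHecke.act_X, QMHecke.actX_apply]
  · rw [QMHecke.act_Y, QMHecke.actY_apply]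
  · rw [QMHecke.act_δ, QMHecke.actδ_apply]
  -- Evaluated on a pure tensor, compatibility becomes the Sweedler formula for any representation
  -- of the coproduct as a finite sum.
  · have e := QMHecke.act_lift h (F₁ ⊗ₜ[ℂ] F₂)
    rw [← QMHecke.H1.comul_eq, hh, map_sum, LinearMap.sum_apply, map_sum] at e
    exact e
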